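/- Let $d\ge 1$ and let $C([0,1]^d)$ be the space of continuous functions $f:[0,1]^d\to\mathbb R$ with the supremum metric. For $f\in C([0,1]^d)$ let $H_f\subset\mathbb R^{d}\times\mathbb R$ be the convex hull of the graph $\{(x,f(x)):x\in[0,1]^d\}$, and for $x\in[0,1]^d$ put $$\varphi_{1,f}(x)=\max\{y:(x,y)\in H_f\},\qquad \varphi_{2,f}(x)=\min\{y:(x,y)\in H_f\},\qquad E_{i,f}=\{x\in[0,1]^d:\varphi_{i,f}(x)=f(x)\}.$$ For a bounded function $\varphi:[0,1]^d\to\mathbb R$, a point $x\in[0,1]^d$ and $h\ge 0$, write $\varphi\in C^h_x$ if there are a polynomial $P$ in $d$ variables of degree at most $[h]$ (the integer part of $h$) and a constant $C$ such that $|\varphi(x')-P(x'-x)|\le C|x'-x|^h$ for all $x'\in[0,1]^d$ sufficiently close to $x$. The pointwise Hölder exponent is $h_\varphi(x)=\sup\{h\ge 0:\varphi\in C^h_x\}\in[0,+\infty]$; put $\mathbf E^h_\varphi=\{x\in[0,1]^d:h_\varphi(x)=h\}$ and $d_\varphi(h)=\dim_H\mathbf E^h_\varphi$, where $\dim_H$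 is the Hausdorff dimension, with $\dim_H\emptyset=-\infty$. For $j=1,\dots,d$ let $F_{0,j}=\{x\in[0,1]^d:x_j=0\}$ and $F_{1,j}=\{x\in[0,1]^d:x_j=1\}$, and let $\partial_{j,+}$, $\partial_{j,-}$ denote the right and left partial derivatives in the $j$-th variable (limits of difference quotients in $[-\infty,+\infty]$). There exists a dense $G_\delta$ set $\mathcal G\subseteq C([0,1]^d)$ such that for every $f\in\mathcal G$ and for $i=1,2$: - $\varphi_{i,f}$ is continuously differentiable on $(0,1)^d$; - $h_{\varphi_{i,f}}(x)=0$ for every $x\in\partial([0,1]^d)$; moreover $d_{\varphi_{i,f}}(0)=d-1$ and $\mathbf E^0_{\varphi_{i,f}}\cap(0,1)^d=\emptyset$; - $d_{\varphi_{i,f}}(1)=d-1$; - $d_{\varphi_{i,f}}(+\infty)=d$; - $d_{\varphi_{i,f}}(h)=-\infty$, that is, $\mathbf E^h_{\varphi_{i,f}}=\emptyset$, for every $h\in(0,+\infty)\setminus\{1\}$; - for every $j=1,\dots,d$: $\partial_{j,+}\varphi_{i,f}(x)=(-1)^{i+1}(+\infty)$ if $x\in F_{0,j}$, and $\partial_{j,-}\varphi_{i,f}(x)=(-1)^{i}(+\infty)$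 if $x\in F_{1,j}$; - $\dim_H E_{i,f}=0$. -/

import Mathlib

open Set Filter Topology
open scoped NNReal ENNReal

noncomputable section

namespace ConvexHullGraph

/-- The closed cube `[0,1]^d`, with the Euclidean metric. -/
def cube (d : ℕ) : Set (EuclideanSpace ℝ (Fin d)) :=
  {x | ∀ j, x j ∈ Icc (0 : ℝ) 1}

/-- The open cube `(0,1)^d`. -/
def openCube (d : ℕ) : Set (EuclideanSpace ℝ (Fin d)) :=
  {x | ∀ j, x j ∈ Ioo (0 : ℝ) 1}

/-- The face of `[0,1]^d` on which the `j`-th coordinate equals `a` (used for `a = 0, 1`). -/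
def face {d : ℕ} (a : ℝ) (j : Fin d) : Set (EuclideanSpace ℝ (Fin d)) :=
  {x | x ∈ cube d ∧ x j = a}

theorem isCompact_cube (d : ℕ) : IsCompact (cube d) := by
  have h : cube d = (EuclideanSpace.equiv (Fin d) ℝ).toHomeomorph ⁻¹'
      (Set.pi univ fun _ => Icc (0 : ℝ) 1) := by
    ext x
    simp only [cube, mem_ofPred_eq, mem_preimage, mem_univ_pi]
    exact Iff.rfl
  rw [h, Homeomorph.isCompact_preimage]
  exact isCompact_univ_pi fun _ => isCompact_Icc

/-- Compactness of the cube: `C(cube d, ℝ)` thereby carries the supremum metric, whose topology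
is the topology that Mathlib puts on `C(cube d, ℝ)`. -/
instance instCompactSpaceCube (d : ℕ) : CompactSpace (cube d) :=
  isCompact_iff_compactSpace.mp (isCompact_cube d)

/-- The convex hull `H_f` of the graph of `f`, a (compact) subset of `ℝ^d × ℝ`. -/
def graphHull {d : ℕ} (f : C(cube d, ℝ)) : Set (EuclideanSpace ℝ (Fin d) × ℝ) :=
  convexHull ℝ (range fun x : cube d => ((x : EuclideanSpace ℝ (Fin d)), f x))

/-- The function on the top (`i = 1`), `x ↦ max {y | (x, y) ∈ H_f}`, and on the bottom (`i = 2`),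
`x ↦ min {y | (x, y) ∈ H_f}`, of `H_f`. For `x` in the cube the extrema are attained; the values
outside the cube are irrelevant. -/
def envelope {d : ℕ} (i : ℕ) (f : C(cube d, ℝ)) (x : EuclideanSpace ℝ (Fin d)) : ℝ :=
  if i = 1 then sSup {y | (x, y) ∈ graphHull f} else sInf {y | (x, y) ∈ graphHull f}

/-- The set of the points of the cube at which `f` coincides with its `i`-th envelope. -/
def contactSet {d : ℕ} (i : ℕ) (f : C(cube d, ℝ)) : Set (EuclideanSpace ℝ (Fin d)) :=
  {x | ∃ hx : x ∈ cube d, envelope i f x = f ⟨x, hx⟩}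

/-- `φ ∈ C^h_x` for a function `φ` on the cube: `φ` agrees near `x`, within the cube, with a
polynomial of degree at most `[h]` in `y - x`, up to an error `O(|y - x|^h)`. -/
def MemHolderAt {d : ℕ} (φ : EuclideanSpace ℝ (Fin d) → ℝ) (h : ℝ≥0)
    (x : EuclideanSpace ℝ (Fin d)) : Prop :=
  ∃ P : MvPolynomial (Fin d) ℝ, P.totalDegree ≤ ⌊h⌋₊ ∧ ∃ C : ℝ,
    ∀ᶠ y in 𝓝[cube d] x,
      |φ y - MvPolynomial.eval (fun j => y j - x j) P| ≤ C * ‖y - x‖ ^ (h : ℝ)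

/-- The pointwise Hölder exponent `sup {h ≥ 0 | φ ∈ C^h_x}`, with values in `[0, ∞]`. -/
def holderExponent {d : ℕ} (φ : EuclideanSpace ℝ (Fin d) → ℝ)
    (x : EuclideanSpace ℝ (Fin d)) : ℝ≥0∞ :=
  sSup {e : ℝ≥0∞ | ∃ h : ℝ≥0, MemHolderAt φ h x ∧ e = (h : ℝ≥0∞)}

/-- The set of the points of the cube at which `φ` has Hölder exponent `h`. -/
def holderLevelSet {d : ℕ} (φ : EuclideanSpace ℝ (Fin d) → ℝ) (h : ℝ≥0∞) :
    Set (EuclideanSpace ℝ (Fin d)) :=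
  {x | x ∈ cube d ∧ holderExponent φ x = h}

open Classical in
/-- Hausdorff dimension with the convention that the empty set has dimension `-∞`. -/
def hausdorffDim {d : ℕ} (s : Set (EuclideanSpace ℝ (Fin d))) : EReal :=
  if s = ∅ then ⊥ else ((dimH s : ℝ≥0∞) : EReal)

/-- The singularity spectrum of a function on the cube. -/
def spectrumHolder {d : ℕ} (φ : EuclideanSpace ℝ (Fin d) → ℝ) (h : ℝ≥0∞) : EReal :=
  hausdorffDim (holderLevelSet φ h)

/-- The right-hand `j`-th partial derivative of `φ` at `x` exists in `[-∞, ∞]` and equals `L`. -/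
def HasRightPartial {d : ℕ} (φ : EuclideanSpace ℝ (Fin d) → ℝ) (j : Fin d)
    (x : EuclideanSpace ℝ (Fin d)) (L : EReal) : Prop :=
  Tendsto (fun t : ℝ => (((φ (x + t • EuclideanSpace.single j (1 : ℝ)) - φ x) / t : ℝ) : EReal))
    (𝓝[>] 0) (𝓝 L)

/-- The left-hand `j`-th partial derivative of `φ` at `x` exists in `[-∞, ∞]` and equals `L`. -/
def HasLeftPartial {d : ℕ} (φ : EuclideanSpace ℝ (Fin d) → ℝ) (j : Fin d)
    (x : EuclideanSpace ℝ (Fin d)) (L : EReal) : Prop :=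
  Tendsto (fun t : ℝ => (((φ (x + t • EuclideanSpace.single j (1 : ℝ)) - φ x) / t : ℝ) : EReal))
    (𝓝[<] 0) (𝓝 L)

end ConvexHullGraph

end

/-! It suffices to treat the upper envelope of a typical `f`: the lower envelope of `f` is minus the
upper envelope of `-f`, and negation is a homeomorphism of the function space. The upper envelope is
concave, and over an interior point `x` it is touched by an affine majorant of `f`
(`exists_majorant`). Its value at `x` is a convex combination of values of `f` at points where that
majorant touches `f`.

By Carathéodory at most `d + 1` affinely independent touching points are needed
(`affine_or_lowRep`). If all `d + 1` occur, `x` is interior to a simplex on which the envelope is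
affine, and the exponent is infinite. Otherwise `x` has a representation by `d` touching points
(`LowRep`). The proof shows that for typical `f` such points have exponent exactly 1 and form a set
that is small, but not too small.

Four generic properties carry this; each is obtained by approximating an arbitrary function by one
having the property with a margin at some small scale. `SteepAlong`: a thin layer added along a face
makes the envelope rise there faster than any Hölder rate, so the boundary exponent is 0, normal
derivatives are infinite, and affine majorants touch `f` only at interior points. `WedgeFree`:
sup-convolutions are semiconvex, so `f` cannot lie below a wedge with apex on its graph. Two
distinct supergradients of the envelope at one point would create such a wedge at a touching point;
hence the envelope is differentiable, and compactness makes it C¹. `ThinContact`: functions with a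
gap below their interpolation on a finite set have contact points only near that set. `SharpRidges`:
when the finite data are in general position, a majorant touching at only `d` prescribed nodes can
be tilted about them, so the polyhedral envelope has a genuine crease there. A small perturbation
keeps a very negative second difference, which excludes exponents above 1.

For the dimensions, thinness covers the `LowRep` points by neighbourhoods of few simplices of
dimension at most `d - 1`, giving the upper bound `d - 1` (`dimH_lowRep_le`). Conversely, the
envelope cannot be locally affine all along a segment normal to a face, because its slope is
infinite at the face (`exists_not_affine_on_line`). Every such segment therefore meets the `LowRep`
points, and projection along the segments gives the lower bound. What remains of the open cube has
exponent infinity and full dimension. -/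

namespace ConvexHullGraph

/-- The Euclidean space containing the cube. -/
abbrev Space (d : ℕ) := EuclideanSpace ℝ (Fin d)

/-! ### Convex combinations and compactness of convex hulls -/

/-- Padding with zero weights at a repeated point. Quantifying over `F` lets the same weights serve
for barycentres of vectors and of points of a subtype. -/
theorem exists_fin_weights {ι α V : Type*} [Fintype ι] [AddCommGroup V] [Module ℝ V] {N : ℕ}
    (hN : Fintype.card ι ≤ N) (z : ι → α) (w : ι → ℝ) (hw : ∀ i, 0 ≤ w i) (h1 : ∑ i, w i = 1) :
    ∃ (z' : Fin N → α) (w' : Fin N → ℝ), (∀ k, 0 ≤ w' k) ∧ ∑ k, w' k = 1 ∧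
      (∀ k, z' k ∈ range z) ∧ ∀ F : α → V, ∑ k, w' k • F (z' k) = ∑ i, w i • F (z i) := by
  classical
  have hne : Nonempty ι := by
    by_contra h
    rw [not_nonempty_iff] at h
    simp at h1
  obtain ⟨i₀⟩ := hne
  obtain ⟨e⟩ : Nonempty (ι ↪ Fin N) :=
    Function.Embedding.nonempty_of_card_le (by simpa using hN)
  have hz : ∀ i, Function.extend e z (fun _ => z i₀) (e i) = z i := fun i =>
    e.injective.extend_apply _ _ _
  have hwe : ∀ i, Function.extend e w 0 (e i) = w i := fun i => e.injective.extend_apply _ _ _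
  have hw0 : ∀ k ∉ range e, Function.extend e w 0 k = 0 := fun k hk => by
    rw [Function.extend_apply' _ _ _ hk]; rfl
  refine ⟨Function.extend e z (fun _ => z i₀), Function.extend e w 0, ?_, ?_, ?_, ?_⟩
  · intro k
    by_cases hk : k ∈ range e
    · obtain ⟨i, rfl⟩ := hk
      rw [hwe]; exact hw i
    · rw [hw0 k hk]
  · rw [← h1]
    exact (Fintype.sum_of_injective e e.injective _ _ hw0 fun i => (hwe i).symm).symm
  · intro k
    by_cases hk : k ∈ range e
    · obtain ⟨i, rfl⟩ := hk
      rw [hz]; exact mem_range_self i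
    · rw [Function.extend_apply' _ _ _ hk]; exact mem_range_self i₀
  · intro F
    refine (Fintype.sum_of_injective e e.injective _ _ (fun k hk => ?_) fun i => ?_).symm
    · rw [hw0 k hk, zero_smul]
    · rw [hwe, hz]

/-- By Carathéodory the hull is the continuous image of a compact product of a simplex with copies
of `s`. -/
theorem isCompact_convexHull {V : Type*} [NormedAddCommGroup V] [NormedSpace ℝ V]
    [FiniteDimensional ℝ V] {s : Set V} (hs : IsCompact s) : IsCompact (convexHull ℝ s) := by
  set N := Module.finrank ℝ V + 1
  have h : convexHull ℝ s = (fun p : (Fin N → ℝ) × (Fin N → V) => ∑ k, p.1 k • p.2 k) ''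
      (stdSimplex ℝ (Fin N) ×ˢ Set.pi univ fun _ => s) := by
    ext x
    constructor
    · intro hx
      obtain ⟨ι, _, z, w, hz, hai, hw, h1, hsum⟩ := eq_pos_convex_span_of_mem_convexHull hx
      obtain ⟨z', w', hw', h1', hz', hF⟩ := exists_fin_weights (V := V) (N := N)
        ((hai.card_le_finrank_succ).trans
          (Nat.succ_le_succ (Submodule.finrank_le _))) z w (fun i => (hw i).le) h1
      refine ⟨(w', z'), ⟨⟨hw', h1'⟩, fun k _ => hz (hz' k)⟩, ?_⟩
      rw [← hsum]
      exact hF id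
    · rintro ⟨⟨w, z⟩, ⟨⟨hw, h1⟩, hz⟩, rfl⟩
      exact (convex_convexHull ℝ s).sum_mem (fun i _ => hw i) h1
        fun i _ => subset_convexHull ℝ s (hz i (mem_univ i))
  rw [h]
  refine ((isCompact_stdSimplex ℝ (Fin N)).prod (isCompact_univ_pi fun _ => hs)).image ?_
  fun_prop

/-! ### The cube -/

theorem convex_cube (d : ℕ) : Convex ℝ (cube d) := by
  intro x hx y hy a b ha hb hab j
  exact (convex_Icc (0 : ℝ) 1) (hx j) (hy j) ha hb hab

theorem isOpen_openCube (d : ℕ) : IsOpen (openCube d) := by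
  have : openCube d = ⋂ j, {x | x j ∈ Ioo (0 : ℝ) 1} := by
    ext x; simp [openCube]
  rw [this]
  exact isOpen_iInter_of_finite fun j => isOpen_Ioo.preimage (by fun_prop)

theorem openCube_subset_cube (d : ℕ) : openCube d ⊆ cube d := fun _ hx j => Ioo_subset_Icc_self (hx j)

theorem convex_openCube (d : ℕ) : Convex ℝ (openCube d) := by
  intro x hx y hy a b ha hb hab j
  exact (convex_Ioo (0 : ℝ) 1) (hx j) (hy j) ha hb hab

theorem isClosed_cube (d : ℕ) : IsClosed (cube d) := (isCompact_cube d).isClosed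

theorem zero_mem_cube (d : ℕ) : (0 : Space d) ∈ cube d := fun j => by simp

theorem norm_le_sum_abs {d : ℕ} (v : Space d) : ‖v‖ ≤ ∑ j, |v j| := by
  rw [EuclideanSpace.norm_eq]
  refine Real.sqrt_le_iff.2 ⟨Finset.sum_nonneg fun j _ => abs_nonneg _, ?_⟩
  simp only [Real.norm_eq_abs]
  exact Finset.sum_sq_le_sq_sum_of_nonneg fun j _ => abs_nonneg _

theorem norm_le_of_mem_cube {d : ℕ} {x : Space d} (hx : x ∈ cube d) : ‖x‖ ≤ d := by
  refine (norm_le_sum_abs x).trans ?_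
  calc ∑ j, |x j| ≤ ∑ _j : Fin d, (1 : ℝ) := Finset.sum_le_sum fun j _ => by
        rw [abs_of_nonneg (hx j).1]; exact (hx j).2
    _ = d := by simp

theorem abs_apply_le_norm {d : ℕ} (v : Space d) (j : Fin d) : |v j| ≤ ‖v‖ := by
  simpa using PiLp.norm_apply_le v j

theorem exists_mem_face_of_notMem_openCube {d : ℕ} {x : Space d}
    (hx : x ∈ cube d) (hx' : x ∉ openCube d) :
    ∃ j, ∃ a : ℝ, (a = 0 ∨ a = 1) ∧ x ∈ face a j := by
  simp only [openCube, mem_ofPred_eq, not_forall] at hx'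
  obtain ⟨j, hj⟩ := hx'
  refine ⟨j, x j, ?_, hx, rfl⟩
  rcases (hx j).1.eq_or_lt with h | h
  · exact Or.inl h.symm
  · exact Or.inr (le_antisymm (hx j).2 (not_lt.1 fun h' => hj ⟨h, h'⟩))

theorem notMem_openCube_of_mem_frontier {d : ℕ} {x : Space d} (hx : x ∈ frontier (cube d)) :
    x ∈ cube d ∧ x ∉ openCube d := by
  rw [(isClosed_cube d).frontier_eq] at hx
  exact ⟨hx.1, fun h => hx.2 (interior_maximal (openCube_subset_cube d) (isOpen_openCube d) h)⟩

/-! ### The upper envelope -/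

variable {d : ℕ} {f g : C(cube d, ℝ)}

theorem isCompact_graphHull (f : C(cube d, ℝ)) : IsCompact (graphHull f) :=
  isCompact_convexHull (isCompact_range (by fun_prop))

theorem envelope_one (f : C(cube d, ℝ)) (x : Space d) :
    envelope 1 f x = sSup {y | (x, y) ∈ graphHull f} := by simp [envelope]

theorem isCompact_fiber (f : C(cube d, ℝ)) (x : Space d) :
    IsCompact {y : ℝ | (x, y) ∈ graphHull f} := by
  have : {y : ℝ | (x, y) ∈ graphHull f} = Prod.snd '' (graphHull f ∩ ({x} ×ˢ univ)) := by
    ext y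
    constructor
    · intro h
      exact ⟨(x, y), ⟨h, by simp⟩, rfl⟩
    · rintro ⟨⟨a, b⟩, ⟨h, h'⟩, rfl⟩
      simp only [mem_prod, mem_singleton_iff, mem_univ, and_true] at h'
      subst h'
      exact h
  rw [this]
  exact ((isCompact_graphHull f).inter_right (isClosed_singleton.prod isClosed_univ)).image
    continuous_snd

theorem graph_mem_graphHull (f : C(cube d, ℝ)) (x : cube d) : ((x : Space d), f x) ∈ graphHull f :=
  subset_convexHull ℝ _ (mem_range_self x)

theorem le_envelope_of_mem {x : Space d} {y : ℝ} (h : (x, y) ∈ graphHull f) :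
    y ≤ envelope 1 f x := by
  rw [envelope_one]
  exact le_csSup (isCompact_fiber f x).bddAbove h

theorem envelope_mem_graphHull {x : Space d} (hx : x ∈ cube d) :
    (x, envelope 1 f x) ∈ graphHull f := by
  rw [envelope_one]
  exact (isCompact_fiber f x).sSup_mem ⟨_, graph_mem_graphHull f ⟨x, hx⟩⟩

theorem le_envelope (f : C(cube d, ℝ)) (x : cube d) : f x ≤ envelope 1 f x :=
  le_envelope_of_mem (graph_mem_graphHull f x)

theorem sum_le_envelope {ι : Type*} [Fintype ι] {w : ι → ℝ} {z : ι → cube d} {x : Space d}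
    (hw : ∀ i, 0 ≤ w i) (h1 : ∑ i, w i = 1) (hx : ∑ i, w i • (z i : Space d) = x) :
    ∑ i, w i * f (z i) ≤ envelope 1 f x := by
  apply le_envelope_of_mem
  have := (convex_convexHull ℝ (range fun x : cube d => ((x : Space d), f x))).sum_mem
    (t := Finset.univ) (fun i _ => hw i) h1 (fun i _ => graph_mem_graphHull f (z i))
  rw [graphHull]
  convert this using 1
  ext1
  · simp [← hx, Prod.fst_sum]
  · simp [Prod.snd_sum]

theorem exists_sum_eq_envelope (f : C(cube d, ℝ)) {x : Space d} (hx : x ∈ cube d) :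
    ∃ (ι : Type) (_ : Fintype ι) (w : ι → ℝ) (z : ι → cube d), (∀ i, 0 < w i) ∧ ∑ i, w i = 1 ∧
      ∑ i, w i • (z i : Space d) = x ∧ ∑ i, w i * f (z i) = envelope 1 f x := by
  obtain ⟨ι, _, z, w, hz, -, hw, h1, hsum⟩ :=
    eq_pos_convex_span_of_mem_convexHull (envelope_mem_graphHull (f := f) hx)
  have : ∀ i, ∃ y : cube d, ((y : Space d), f y) = z i := fun i => hz (mem_range_self i)
  choose y hy using this
  refine ⟨ι, inferInstance, w, y, hw, h1, ?_, ?_⟩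
  · have := congrArg Prod.fst hsum
    simpa [Prod.fst_sum, ← hy] using this
  · have := congrArg Prod.snd hsum
    simpa [Prod.snd_sum, ← hy] using this

theorem concaveOn_envelope (f : C(cube d, ℝ)) : ConcaveOn ℝ (cube d) (envelope 1 f) := by
  refine ⟨convex_cube d, fun x hx y hy a b ha hb hab => le_envelope_of_mem ?_⟩
  exact convex_convexHull ℝ _ (envelope_mem_graphHull hx) (envelope_mem_graphHull hy) ha hb hab

theorem envelope_le_of_majorant {p : Space d} {c : ℝ} (h : ∀ y : cube d, f y ≤ inner ℝ p y + c)
    {x : Space d} (hx : x ∈ cube d) : envelope 1 f x ≤ inner ℝ p x + c := by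
  obtain ⟨ι, _, w, z, hw, h1, hsum, hval⟩ := exists_sum_eq_envelope f hx
  calc envelope 1 f x = ∑ i, w i * f (z i) := hval.symm
    _ ≤ ∑ i, w i * (inner ℝ p (z i : Space d) + c) :=
        Finset.sum_le_sum fun i _ => mul_le_mul_of_nonneg_left (h _) (hw i).le
    _ = inner ℝ p x + c := by
        rw [← hsum, inner_sum]
        simp only [mul_add, Finset.sum_add_distrib, ← Finset.sum_mul, h1, one_mul,
          real_inner_smul_right]

theorem envelope_le_envelope_add {c : ℝ} (h : ∀ y, f y ≤ g y + c) {x : Space d} (hx : x ∈ cube d) :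
    envelope 1 f x ≤ envelope 1 g x + c := by
  obtain ⟨ι, _, w, z, hw, h1, hsum, hval⟩ := exists_sum_eq_envelope f hx
  calc envelope 1 f x = ∑ i, w i * f (z i) := hval.symm
    _ ≤ ∑ i, w i * (g (z i) + c) :=
        Finset.sum_le_sum fun i _ => mul_le_mul_of_nonneg_left (h _) (hw i).le
    _ = ∑ i, w i * g (z i) + c := by
        simp only [mul_add, Finset.sum_add_distrib, ← Finset.sum_mul, h1, one_mul]
    _ ≤ _ := by gcongr; exact sum_le_envelope (fun i => (hw i).le) h1 hsum

theorem abs_envelope_sub_le {η : ℝ} (h : ∀ y, |f y - g y| ≤ η) {x : Space d} (hx : x ∈ cube d) :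
    |envelope 1 f x - envelope 1 g x| ≤ η := by
  rw [abs_le]
  have h1 := envelope_le_envelope_add (f := f) (g := g) (c := η)
    (fun y => by linarith [(abs_le.1 (h y)).2]) hx
  have h2 := envelope_le_envelope_add (f := g) (g := f) (c := η)
    (fun y => by linarith [(abs_le.1 (h y)).1]) hx
  constructor <;> linarith

theorem abs_envelope_le {M : ℝ} (h : ∀ y, |f y| ≤ M) {x : Space d} (hx : x ∈ cube d) :
    |envelope 1 f x| ≤ M := by
  rw [abs_le]
  constructor
  · exact ((abs_le.1 (h ⟨x, hx⟩)).1).trans (le_envelope f ⟨x, hx⟩)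
  · simpa using envelope_le_of_majorant (f := f) (p := 0) (c := M)
      (fun y => by simpa using (abs_le.1 (h y)).2) hx

/-- Equality in an average of nonnegative gaps with strictly positive weights forces every gap to
vanish. -/
theorem eq_of_majorant_of_sum_eq {ι : Type*} [Fintype ι] {w : ι → ℝ} {z : ι → cube d}
    {p : Space d} {c : ℝ} (h : ∀ y : cube d, f y ≤ inner ℝ p y + c)
    (hw : ∀ i, 0 < w i) (h1 : ∑ i, w i = 1)
    (hsum : ∑ i, w i * f (z i) = inner ℝ p (∑ i, w i • (z i : Space d)) + c) (i : ι) :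
    f (z i) = inner ℝ p (z i : Space d) + c := by
  have h0 : ∑ i, w i * (inner ℝ p (z i : Space d) + c - f (z i)) = 0 := by
    simp only [mul_sub, mul_add, Finset.sum_sub_distrib, Finset.sum_add_distrib, hsum,
      ← Finset.sum_mul, h1, inner_sum, real_inner_smul_right]
    ring
  rw [Finset.sum_eq_zero_iff_of_nonneg
    fun i _ => mul_nonneg (hw i).le (by linarith [h (z i)])] at h0
  have := (mul_eq_zero.1 (h0 i (Finset.mem_univ i))).resolve_left (hw i).ne'
  linarith

/-- Hahn–Banach separates the point of the graph from the strict hypograph over the open cube, which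
is open because a concave function is continuous there. The separating functional has positive
vertical component, hence is the graph of an affine function. -/
theorem exists_majorant (f : C(cube d, ℝ)) {x : Space d} (hx : x ∈ openCube d) :
    ∃ (p : Space d) (c : ℝ), (∀ y : cube d, f y ≤ inner ℝ p y + c) ∧
      envelope 1 f x = inner ℝ p x + c := by
  have hconc := (concaveOn_envelope f).subset (openCube_subset_cube d) (convex_openCube d)
  have hcont := hconc.continuousOn (isOpen_openCube d)
  set s : Set (Space d × ℝ) := {q | q.1 ∈ openCube d ∧ q.2 < envelope 1 f q.1}
  have hs : IsOpen s := by
    rw [isOpen_iff_mem_nhds]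
    rintro ⟨y, t⟩ ⟨hy, ht⟩
    have h1 : ∀ᶠ q : Space d × ℝ in 𝓝 (y, t), q.1 ∈ openCube d :=
      continuous_fst.continuousAt.eventually ((isOpen_openCube d).mem_nhds hy)
    have h2 : Tendsto (fun q : Space d × ℝ => envelope 1 f q.1) (𝓝 (y, t)) (𝓝 (envelope 1 f y)) :=
      ((hcont.continuousAt ((isOpen_openCube d).mem_nhds hy)).tendsto).comp
        continuous_fst.continuousAt
    have h3 : Tendsto (fun q : Space d × ℝ => q.2) (𝓝 (y, t)) (𝓝 t) :=
      continuous_snd.continuousAt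
    filter_upwards [h1, h3.eventually_lt h2 ht] with q hq hq'
    exact ⟨hq, hq'⟩
  obtain ⟨F, hF⟩ := geometric_hahn_banach_open_point (x := (x, envelope 1 f x))
    hconc.convex_strict_hypograph hs (fun h => lt_irrefl _ h.2)
  set b := F (0, 1)
  have hsplit : ∀ y t, F (y, t) = F (y, 0) + t * b := fun y t => by
    have : (y, t) = (y, (0 : ℝ)) + t • ((0 : Space d), (1 : ℝ)) := by simp
    rw [this, map_add, map_smul, smul_eq_mul]
  have hb : 0 < b := by
    have := hF (x, envelope 1 f x - 1) ⟨hx, by simp⟩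
    rw [hsplit, hsplit x (envelope 1 f x)] at this
    linarith
  have hle : ∀ y ∈ openCube d, F (y, 0) + envelope 1 f y * b ≤ F (x, 0) + envelope 1 f x * b := by
    intro y hy
    refine le_of_forall_pos_lt_add fun ε hε => ?_
    have := hF (y, envelope 1 f y - ε / b) ⟨hy, by simp; positivity⟩
    rw [hsplit, hsplit x (envelope 1 f x), sub_mul, div_mul_cancel₀ _ hb.ne'] at this
    linarith
  -- The separation is known only over the open cube; concavity along the segment from `y` to `x`,
  -- whose relative interior lies in the open cube, carries it to boundary points `y`.
  have hle' : ∀ y : cube d, F (y, 0) + f y * b ≤ F (x, 0) + envelope 1 f x * b := by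
    intro y
    have hmem : ∀ t : ℝ, t ∈ Ioo (0 : ℝ) 1 → (1 - t) • (y : Space d) + t • x ∈ openCube d := by
      intro t ht j
      have h1 := y.2 j
      have h2 := hx j
      simp only [PiLp.add_apply, PiLp.smul_apply, smul_eq_mul]
      constructor
      · have := mul_nonneg (sub_pos.2 ht.2).le h1.1
        have := mul_pos ht.1 h2.1
        linarith
      · have := mul_le_mul_of_nonneg_left h1.2 (sub_pos.2 ht.2).le
        have := mul_lt_mul_of_pos_left h2.2 ht.1
        linarith
    have key : ∀ t ∈ Ioo (0 : ℝ) 1,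
        F (y, 0) + envelope 1 f y * b ≤ F (x, 0) + envelope 1 f x * b := by
      intro t ht
      have h1 := hle _ (hmem t ht)
      have h2 := (concaveOn_envelope f).2 y.2 (openCube_subset_cube d hx) (sub_pos.2 ht.2).le
        ht.1.le (by ring)
      have h3 : F ((1 - t) • (y : Space d) + t • x, 0) = (1 - t) * F (y, 0) + t * F (x, 0) := by
        have : ((1 - t) • (y : Space d) + t • x, (0 : ℝ)) = (1 - t) • ((y : Space d), (0 : ℝ))
          + t • (x, (0 : ℝ)) := by simp
        rw [this, map_add, map_smul, map_smul, smul_eq_mul, smul_eq_mul]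
      simp only [smul_eq_mul] at h2
      have h4 := mul_le_mul_of_nonneg_right h2 hb.le
      rw [h3] at h1
      have h5 : 0 < 1 - t := sub_pos.2 ht.2
      refine le_of_mul_le_mul_left ?_ h5
      nlinarith
    have := key (1 / 2) ⟨by norm_num, by norm_num⟩
    have h6 := mul_le_mul_of_nonneg_right (le_envelope f y) hb.le
    linarith
  set G : Space d →L[ℝ] ℝ := -(b⁻¹) • F.comp (ContinuousLinearMap.inl ℝ (Space d) ℝ)
  set p := (InnerProductSpace.toDual ℝ (Space d)).symm G
  have hp : ∀ y, inner ℝ p y = -(b⁻¹) * F (y, 0) := fun y => by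
    rw [InnerProductSpace.toDual_symm_apply]; simp [G]
  refine ⟨p, envelope 1 f x - inner ℝ p x, fun y => ?_, by ring⟩
  rw [hp, hp]
  have := hle' y
  refine le_of_mul_le_mul_right ?_ hb
  field_simp
  linarith

/-- Moving from `x` by `r` against `p` lowers the affine function by `r * ‖p‖`, yet it must stay
above `-M`. -/
theorem norm_le_of_majorant {M r : ℝ} (hr : 0 < r) (hM : ∀ y, |f y| ≤ M) {x p : Space d} {c : ℝ}
    (hx : Metric.closedBall x r ⊆ cube d) (h : ∀ y : cube d, f y ≤ inner ℝ p y + c)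
    (hval : inner ℝ p x + c ≤ M) : ‖p‖ ≤ 2 * M / r := by
  by_cases hp : p = 0
  · have : 0 ≤ M := (abs_nonneg _).trans (hM ⟨0, zero_mem_cube d⟩)
    rw [hp, norm_zero]; positivity
  have hp' : 0 < ‖p‖ := norm_pos_iff.2 hp
  have hy : x - (r / ‖p‖) • p ∈ cube d := hx (by
    rw [Metric.mem_closedBall, dist_eq_norm, sub_sub_cancel_left, norm_neg, norm_smul,
      Real.norm_of_nonneg (by positivity), div_mul_cancel₀ _ hp'.ne'])
  have h1 := h ⟨_, hy⟩
  have h2 := (abs_le.1 (hM ⟨_, hy⟩)).1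
  simp only [inner_sub_right, real_inner_smul_right, real_inner_self_eq_norm_sq] at h1
  have h3 : r / ‖p‖ * ‖p‖ ^ 2 = r * ‖p‖ := by field_simp
  rw [le_div_iff₀ hr]
  linarith

theorem mem_contactSet_of_majorant {p : Space d} {c : ℝ}
    (h : ∀ y : cube d, f y ≤ inner ℝ p y + c) {z : cube d} (hz : f z = inner ℝ p (z : Space d) + c) :
    (z : Space d) ∈ contactSet 1 f :=
  ⟨z.2, le_antisymm ((envelope_le_of_majorant h z.2).trans hz.ge) (le_envelope f z)⟩

theorem exists_closedBall_subset_cube {x : Space d} (hx : x ∈ openCube d) :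
    ∃ r > 0, Metric.closedBall x r ⊆ cube d :=
  Metric.nhds_basis_closedBall.mem_iff.1
    (mem_of_superset ((isOpen_openCube d).mem_nhds hx) (openCube_subset_cube d))

end ConvexHullGraph

namespace ConvexHullGraph

/-! ### Residual properties: steepness at the faces and absence of wedges -/

/-- The hypothesis says that the interior of `S` is dense; every generic property below is
established in this form. -/
theorem mem_residual_of_exists_ball {X : Type*} [PseudoMetricSpace X] {S : Set X}
    (h : ∀ x, ∀ ε > 0, ∃ y, dist y x < ε ∧ ∃ η > 0, Metric.ball y η ⊆ S) : S ∈ residual X := by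
  refine mem_of_superset (residual_of_dense_open isOpen_interior ?_) interior_subset
  rw [Metric.dense_iff]
  intro x ε hε
  obtain ⟨y, hy, η, hη, hS⟩ := h x ε hε
  exact ⟨y, hy, mem_interior.2 ⟨_, hS, Metric.isOpen_ball, Metric.mem_ball_self hη⟩⟩

theorem eventually_mul_rpow_lt {s : ℝ} (hs : 0 < s) (N : ℝ) {ε : ℝ} (hε : 0 < ε) :
    ∀ᶠ δ in 𝓝[>] (0 : ℝ), N * δ ^ s < ε := by
  have h : Tendsto (fun δ : ℝ => N * δ ^ s) (𝓝[>] 0) (𝓝 (N * 0 ^ s)) :=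
    (((Real.continuousAt_rpow_const 0 s (Or.inr hs.le)).tendsto).const_mul N).mono_left
      nhdsWithin_le_nhds
  rw [Real.zero_rpow hs.ne', mul_zero] at h
  exact h.eventually_lt_const hε

theorem eventually_lt_nhdsGT_zero {ε : ℝ} (hε : 0 < ε) : ∀ᶠ δ in 𝓝[>] (0 : ℝ), δ < ε :=
  nhdsWithin_le_nhds (gt_mem_nhds hε)

variable {d : ℕ} {f g : C(cube d, ℝ)}

theorem abs_sub_le_of_mem_ball {η : ℝ} (h : f ∈ Metric.ball g η) (y : cube d) :
    |f y - g y| ≤ η :=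
  (ContinuousMap.dist_apply_le_dist (f := f) (g := g) y).trans (Metric.mem_ball.1 h).le

theorem exists_modulus (f : C(cube d, ℝ)) {ε : ℝ} (hε : 0 < ε) :
    ∃ δ > 0, ∀ x y : cube d, dist (x : Space d) y < δ → |f x - f y| < ε :=
  have ⟨δ, hδ, h⟩ := Metric.uniformContinuous_iff.1
    (CompactSpace.uniformContinuous_of_continuous f.continuous) ε hε
  ⟨δ, hδ, fun _ _ hxy => h hxy⟩

/-- The inward translation by `t` from the face of the cube on which the `j`-th coordinate
is `a`, for `a = 0` or `a = 1`. -/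
noncomputable def inward (a : ℝ) (j : Fin d) (t : ℝ) (x : Space d) : Space d :=
  x + t • ((1 - 2 * a) • EuclideanSpace.single j (1 : ℝ))

theorem inward_apply_self (a : ℝ) (j : Fin d) (t : ℝ) (x : Space d) :
    inward a j t x j = x j + t * (1 - 2 * a) := by
  simp [inward]

theorem inward_apply_of_ne (a : ℝ) {j k : Fin d} (hk : k ≠ j) (t : ℝ) (x : Space d) :
    inward a j t x k = x k := by
  simp [inward, hk]

theorem inward_mem_cube {a : ℝ} (ha : a = 0 ∨ a = 1) {j : Fin d} {t : ℝ} (ht : t ∈ Icc (0 : ℝ) 1)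
    {x : Space d} (hx : x ∈ face a j) : inward a j t x ∈ cube d := by
  intro k
  by_cases hk : k = j
  · subst hk
    rw [inward_apply_self, hx.2]
    rcases ha with rfl | rfl <;> constructor <;> linarith [ht.1, ht.2]
  · rw [inward_apply_of_ne a hk]
    exact hx.1 k

theorem norm_inward_sub {a : ℝ} (ha : a = 0 ∨ a = 1) (j : Fin d) {t : ℝ} (ht : 0 ≤ t)
    (x : Space d) : ‖inward a j t x - x‖ = t := by
  have : |1 - 2 * a| = 1 := by rcases ha with rfl | rfl <;> norm_num
  simp [inward, norm_smul, this, abs_of_nonneg ht]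

/-- Along the face where the `j`-th coordinate is `a`, the upper envelope of `f` increases, at
some small scale `δ`, by more than `(n + 1) δ ^ (1 / (n + 1))`. -/
def SteepAlong (a : ℝ) (j : Fin d) (n : ℕ) (f : C(cube d, ℝ)) : Prop :=
  ∃ δ : ℝ, 0 < δ ∧ δ < 1 / (n + 1) ∧ ∀ x ∈ face a j,
    (n + 1) * δ ^ (1 / ((n : ℝ) + 1)) < envelope 1 f (inward a j δ x) - envelope 1 f x

/-- A face is extreme, so a convex combination representing a point of it uses points of the face
only, and the whole combination can be translated inward. -/
theorem envelope_add_le_of_face {a : ℝ} (ha : a = 0 ∨ a = 1) {j : Fin d} {t k : ℝ}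
    (ht : t ∈ Icc (0 : ℝ) 1)
    (h : ∀ z z' : cube d, (z : Space d) ∈ face a j → (z' : Space d) = inward a j t z →
      f z + k ≤ f z') {x : Space d} (hx : x ∈ face a j) :
    envelope 1 f x + k ≤ envelope 1 f (inward a j t x) := by
  obtain ⟨ι, _, w, z, hw, h1, hsum, hval⟩ := exists_sum_eq_envelope f hx.1
  have hface : ∀ i, (z i : Space d) ∈ face a j := by
    -- The factor `1 - 2 * a` is the sign making the distance to the face nonnegative; its weighted
    -- mean vanishes.
    have hs : ∑ i, w i * ((1 - 2 * a) * ((z i : Space d) j - a)) = 0 := by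
      have h2 : ∑ i, w i * (z i : Space d) j = a := by
        rw [← hx.2, ← hsum]; simp
      have : ∀ i, w i * ((1 - 2 * a) * ((z i : Space d) j - a)) =
          (1 - 2 * a) * (w i * (z i : Space d) j) - (1 - 2 * a) * a * w i := fun i => by ring
      simp only [this, Finset.sum_sub_distrib, ← Finset.mul_sum, h1, h2]
      ring
    have hnn : ∀ i, 0 ≤ (1 - 2 * a) * ((z i : Space d) j - a) := fun i => by
      have := (z i).2 j
      rcases ha with rfl | rfl <;> linarith [this.1, this.2]
    rw [Finset.sum_eq_zero_iff_of_nonneg fun i _ => mul_nonneg (hw i).le (hnn i)] at hs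
    intro i
    have := (mul_eq_zero.1 (hs i (Finset.mem_univ i))).resolve_left (hw i).ne'
    have h3 : (1 - 2 * a) ≠ 0 := by rcases ha with rfl | rfl <;> norm_num
    exact ⟨(z i).2, sub_eq_zero.1 ((mul_eq_zero.1 this).resolve_left h3)⟩
  have hle := sum_le_envelope (f := f) (x := inward a j t x)
    (z := fun i => ⟨inward a j t (z i), inward_mem_cube ha ht (hface i)⟩)
    (fun i => (hw i).le) h1 (by
      simp only [inward, smul_add, Finset.sum_add_distrib, hsum, ← Finset.sum_smul, h1, one_smul])
  refine le_trans ?_ hle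
  calc envelope 1 f x + k = ∑ i, w i * (f (z i) + k) := by
        simp only [mul_add, Finset.sum_add_distrib, ← Finset.sum_mul, h1, one_mul, hval]
    _ ≤ _ := Finset.sum_le_sum fun i _ =>
        mul_le_mul_of_nonneg_left (h _ _ (hface i) rfl) (hw i).le

theorem steepAlong_mem_residual {a : ℝ} (ha : a = 0 ∨ a = 1) (j : Fin d) (n : ℕ) :
    {f : C(cube d, ℝ) | SteepAlong a j n f} ∈ residual C(cube d, ℝ) := by
  refine mem_residual_of_exists_ball fun f ε hε => ?_
  obtain ⟨δ₀, hδ₀, hmod⟩ := exists_modulus f (ε := ε / 8) (by positivity)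
  have hn : (0 : ℝ) < n + 1 := by positivity
  obtain ⟨δ, hδpos, hδ1, hδ2, hδ3⟩ := ((eventually_mem_nhdsWithin (a := (0 : ℝ)) (s := Ioi 0)).and
    ((eventually_lt_nhdsGT_zero (one_div_pos.2 hn)).and ((eventually_lt_nhdsGT_zero hδ₀).and
    (eventually_mul_rpow_lt (s := 1 / ((n : ℝ) + 1)) (by positivity) (n + 1)
      (ε := ε / 8) (by positivity))))).exists
  have hδ0 : (0 : ℝ) < δ := hδpos
  have hδle : δ ≤ 1 := hδ1.le.trans (by rw [div_le_one hn]; linarith [n.cast_nonneg (α := ℝ)])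
  -- A layer of width `δ` and height `ε / 2`, zero on the face. The rise `ε / 2` loses at most `ε /
  -- 8` to the modulus of `f` and `2 * (ε / 32)` to the perturbation, leaving more than `ε / 4`.
  let g : C(cube d, ℝ) :=
    ⟨fun x => f x + ε / 2 * min (|(x : Space d) j - a| / δ) 1, by fun_prop⟩
  have hg : ∀ x, g x = f x + ε / 2 * min (|(x : Space d) j - a| / δ) 1 := fun _ => rfl
  refine ⟨g, ?_, ε / 32, by positivity, fun f' hf' => ⟨δ, hδ0, hδ1, fun x hx => ?_⟩⟩
  · rw [ContinuousMap.dist_lt_iff hε]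
    intro x
    rw [Real.dist_eq, hg, add_sub_cancel_left]
    have h1 : 0 ≤ min (|(x : Space d) j - a| / δ) 1 := by positivity
    rw [abs_of_nonneg (by positivity)]
    nlinarith [min_le_right (|(x : Space d) j - a| / δ) 1]
  · have key := envelope_add_le_of_face (f := f') ha (k := ε / 4) ⟨hδ0.le, hδle⟩ (fun z z' hz hz' => by
      have h1 := abs_le.1 (abs_sub_le_of_mem_ball hf' z)
      have h2 := abs_le.1 (abs_sub_le_of_mem_ball hf' z')
      have h3 : g z = f z := by rw [hg, hz.2]; simp
      have h4 : g z' = f z' + ε / 2 := by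
        have : |1 - 2 * a| = 1 := by rcases ha with rfl | rfl <;> norm_num
        rw [hg, hz', inward_apply_self, hz.2, add_sub_cancel_left, abs_mul, this, mul_one,
          abs_of_pos hδ0, div_self hδ0.ne', min_self, mul_one]
      have h5 := abs_lt.1 (hmod z' z (by rw [hz', dist_eq_norm, norm_inward_sub ha j hδ0.le]; exact hδ2))
      linarith [h1.1, h1.2, h2.1, h2.2, h5.1, h5.2]) hx
    linarith

/-- At some small scale the second differences of `f` are not too negative. -/
def WedgeFree (n : ℕ) (f : C(cube d, ℝ)) : Prop :=
  ∃ ρ : ℝ, 0 < ρ ∧ ρ < 1 / (n + 1) ∧ ∀ a b m : cube d, (a : Space d) + b = (2 : ℝ) • (m : Space d) →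
    ‖(a : Space d) - b‖ = 2 * ρ → -(ρ / (n + 1)) ≤ f a + f b - 2 * f m

/-- Sup-convolution: approximation by a function with second differences bounded below. -/
theorem exists_semiconvex_near (f : C(cube d, ℝ)) {ε : ℝ} (hε : 0 < ε) :
    ∃ g : C(cube d, ℝ), dist g f < ε ∧ ∃ M > 0, ∀ a b m : cube d,
      (a : Space d) + b = (2 : ℝ) • (m : Space d) →
      -(M * ‖(a : Space d) - b‖ ^ 2) ≤ g a + g b - 2 * g m := by
  obtain ⟨δ, hδ, hmod⟩ := exists_modulus f (half_pos hε)
  -- With this penalty a point at distance at least `δ` loses more than the oscillation of `f`, so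
  -- maximisers stay within the modulus.
  set M : ℝ := (2 * ‖f‖ + 1) / δ ^ 2
  have hM : 0 < M := by positivity
  let F : cube d → cube d → ℝ := fun x y => f y - M * ‖(x : Space d) - y‖ ^ 2
  have hF : Continuous ↿F := by
    simp only [F, Function.HasUncurry.uncurry]
    fun_prop
  let g : C(cube d, ℝ) := ⟨fun x => sSup (F x '' univ), isCompact_univ.continuous_sSup hF⟩
  have hcomp : ∀ x, IsCompact (F x '' univ) := fun x =>
    isCompact_univ.image (by simp only [F]; fun_prop)
  have hge : ∀ x y, F x y ≤ g x := fun x y =>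
    le_csSup (hcomp x).bddAbove (mem_image_of_mem _ (mem_univ y))
  have hex : ∀ x, ∃ y, F x y = g x := fun x => by
    obtain ⟨y, -, hy⟩ := (hcomp x).sSup_mem ⟨_, mem_image_of_mem _ (mem_univ x)⟩
    exact ⟨y, hy⟩
  refine ⟨g, ?_, M / 2, by positivity, fun a b m hab => ?_⟩
  · rw [ContinuousMap.dist_lt_iff hε]
    intro x
    have h1 : f x ≤ g x := by simpa [F] using hge x x
    obtain ⟨y, hy⟩ := hex x
    have h2 : g x ≤ f x + ε / 2 := by
      rw [← hy]
      by_cases hxy : dist (x : Space d) y < δ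
      · have h3 := abs_lt.1 (hmod x y hxy)
        have h4 : 0 ≤ M * ‖(x : Space d) - y‖ ^ 2 := by positivity
        simp only [F]
        linarith [h3.1]
      · rw [dist_eq_norm, not_lt] at hxy
        have h3 : M * δ ^ 2 ≤ M * ‖(x : Space d) - y‖ ^ 2 := by gcongr
        have h4 : M * δ ^ 2 = 2 * ‖f‖ + 1 := div_mul_cancel₀ _ (by positivity)
        have h5 := abs_le.1 (f.norm_coe_le_norm x)
        have h6 := abs_le.1 (f.norm_coe_le_norm y)
        simp only [F]
        linarith [h5.1, h6.2]
    rw [Real.dist_eq, abs_of_nonneg (by linarith)]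
    linarith
  -- A maximiser for the midpoint competes at both ends; the parallelogram law turns the three
  -- penalties into `M / 2 * ‖a - b‖ ^ 2`.
  · obtain ⟨y, hy⟩ := hex m
    have h1 := hge a y
    have h2 := hge b y
    have hm : (m : Space d) = (2⁻¹ : ℝ) • ((a : Space d) + b) := by
      rw [hab, smul_smul]; norm_num
    have h3 := parallelogram_law_with_norm ℝ ((a : Space d) - y) ((b : Space d) - y)
    have h4 : (a : Space d) - y + (b - y) = (2 : ℝ) • ((m : Space d) - y) := by
      rw [smul_sub, ← hab, two_smul]; abel
    have h5 : (a : Space d) - y - (b - y) = a - b := by abel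
    rw [h4, h5, norm_smul, Real.norm_ofNat] at h3
    rw [← hy]
    simp only [F] at h1 h2 ⊢
    nlinarith

theorem wedgeFree_mem_residual (n : ℕ) :
    {f : C(cube d, ℝ) | WedgeFree n f} ∈ residual C(cube d, ℝ) := by
  refine mem_residual_of_exists_ball fun f ε hε => ?_
  obtain ⟨g, hg, M, hM, hsc⟩ := exists_semiconvex_near f hε
  have hn : (0 : ℝ) < n + 1 := by positivity
  obtain ⟨ρ, hρpos, hρ1, hρ2⟩ := ((eventually_mem_nhdsWithin (a := (0 : ℝ)) (s := Ioi 0)).and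
    ((eventually_lt_nhdsGT_zero (one_div_pos.2 hn)).and
    (eventually_lt_nhdsGT_zero (ε := 1 / (8 * M * (n + 1))) (by positivity)))).exists
  have hρ0 : (0 : ℝ) < ρ := hρpos
  -- The quadratic bound costs at most half of `ρ / (n + 1)` at scale `ρ`; the perturbation enters
  -- four times and costs the other half.
  refine ⟨g, hg, ρ / (8 * (n + 1)), by positivity, fun f' hf' => ⟨ρ, hρ0, hρ1, ?_⟩⟩
  intro a b m hab hnorm
  have h1 := hsc a b m hab
  rw [hnorm] at h1
  have ha := abs_le.1 (abs_sub_le_of_mem_ball hf' a)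
  have hb := abs_le.1 (abs_sub_le_of_mem_ball hf' b)
  have hm := abs_le.1 (abs_sub_le_of_mem_ball hf' m)
  have h2 : M * (2 * ρ) ^ 2 ≤ ρ / (2 * (n + 1)) := by
    rw [lt_div_iff₀ (by positivity)] at hρ2
    rw [le_div_iff₀ (by positivity)]
    nlinarith
  have h3 : ρ / (2 * ((n : ℝ) + 1)) = ρ / (n + 1) / 2 := by field_simp
  have h4 : ρ / (8 * ((n : ℝ) + 1)) = ρ / (n + 1) / 8 := by field_simp
  rw [h3] at h2
  rw [h4] at ha hb hm
  linarith [ha.1, hb.1, hm.2]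

end ConvexHullGraph

namespace ConvexHullGraph

/-! ### Multilinear interpolation on a grid -/

/-- The piecewise linear hat function. -/
noncomputable def hat (t : ℝ) : ℝ := max 0 (1 - |t|)

theorem hat_nonneg (t : ℝ) : 0 ≤ hat t := le_max_left _ _

theorem hat_eq_zero {t : ℝ} (h : 1 ≤ |t|) : hat t = 0 := max_eq_left (by linarith)

theorem hat_eq {t : ℝ} (h : |t| ≤ 1) : hat t = 1 - |t| := max_eq_right (by linarith)

theorem continuous_hat : Continuous hat := by
  unfold hat; fun_prop

theorem hat_natCast_sub (k l : ℕ) : hat ((k : ℝ) - l) = if k = l then 1 else 0 := by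
  split_ifs with h
  · simp [h, hat]
  · refine hat_eq_zero ?_
    have : (1 : ℤ) ≤ |(k : ℤ) - l| := Int.one_le_abs (sub_ne_zero.2 (by exact_mod_cast h))
    exact_mod_cast this

/-- On the last unit interval only the last two hats survive; elsewhere the new hat vanishes, whence
the induction. -/
theorem sum_range_hat (N : ℕ) {t : ℝ} (ht : t ∈ Icc (0 : ℝ) N) :
    ∑ k ∈ Finset.range (N + 1), hat (t - k) = 1 ∧
      ∑ k ∈ Finset.range (N + 1), hat (t - k) * k = t := by
  induction N with
  | zero =>
    have : t = 0 := le_antisymm (by simpa using ht.2) ht.1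
    subst this
    simp [hat]
  | succ N ih =>
    rcases le_total t N with h | h
    · obtain ⟨h1, h2⟩ := ih ⟨ht.1, h⟩
      have h0 : hat (t - (N + 1 : ℕ)) = 0 := hat_eq_zero (by
        push_cast
        rw [abs_of_nonpos (by linarith)]
        linarith)
      rw [Finset.sum_range_succ, Finset.sum_range_succ _ (N + 1), h0, h1, h2]
      simp
    · have h3 : t ≤ N + 1 := by simpa using ht.2
      have h0 : ∀ k ∈ Finset.range N, hat (t - k) = 0 := fun k hk => by
        have : (k : ℝ) + 1 ≤ N := by exact_mod_cast Finset.mem_range.1 hk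
        refine hat_eq_zero ?_
        rw [abs_of_nonneg (by linarith)]
        linarith
      have h1 : hat (t - N) = 1 - (t - N) := by
        rw [hat_eq, abs_of_nonneg] <;> [skip; rw [abs_of_nonneg]] <;> linarith
      have h2 : hat (t - (N + 1 : ℕ)) = 1 - (N + 1 - t) := by
        push_cast
        rw [hat_eq, abs_of_nonpos] <;> [skip; skip; rw [abs_of_nonpos]] <;> linarith
      rw [Finset.sum_range_succ, Finset.sum_range_succ, Finset.sum_range_succ _ (N + 1),
        Finset.sum_range_succ, Finset.sum_eq_zero h0,
        Finset.sum_eq_zero fun k hk => by rw [h0 k hk, zero_mul], h1, h2]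
      push_cast
      constructor <;> ring

theorem sum_fin_hat (N : ℕ) {t : ℝ} (ht : t ∈ Icc (0 : ℝ) N) :
    ∑ k : Fin (N + 1), hat (t - (k : ℕ)) = 1 ∧ ∑ k : Fin (N + 1), hat (t - (k : ℕ)) * (k : ℕ) = t := by
  have := sum_range_hat N ht
  rwa [Finset.sum_range, Finset.sum_range] at this

/-- Products of hats on a grid of mesh `1 / N`. Each one-dimensional family reproduces constants and
the identity, so the products reproduce every coordinate and the weights are barycentric. -/
theorem exists_barycentric_partition (d : ℕ) {δ : ℝ} (hδ : 0 < δ) :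
    ∃ (ι : Type) (_ : Fintype ι) (P : ι → cube d) (W : ι → Space d → ℝ),
      Function.Injective P ∧ (∀ i, Continuous (W i)) ∧ (∀ i x, 0 ≤ W i x) ∧
      (∀ x ∈ cube d, ∑ i, W i x = 1) ∧ (∀ x ∈ cube d, ∑ i, W i x • (P i : Space d) = x) ∧
      (∀ i, ∀ x, W i x ≠ 0 → dist (P i : Space d) x < δ) ∧
      (∀ i k, i ≠ k → W i (P k) = 0) := by
  classical
  obtain ⟨N, hN⟩ := exists_nat_gt ((d + 1) / δ)
  have hN0 : (0 : ℝ) < N := lt_trans (by positivity) hN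
  have hmul : ∀ x ∈ cube d, ∀ j, (N : ℝ) * x j ∈ Icc (0 : ℝ) N := fun x hx j =>
    ⟨mul_nonneg hN0.le (hx j).1, by simpa using mul_le_mul_of_nonneg_left (hx j).2 hN0.le⟩
  let P : (Fin d → Fin (N + 1)) → cube d := fun i =>
    ⟨WithLp.toLp 2 fun j => ((i j : ℕ) : ℝ) / N, fun j => by
      constructor
      · simp only; positivity
      · simp only
        rw [div_le_one hN0]
        exact_mod_cast Nat.lt_succ_iff.1 (i j).2⟩
  have hP : ∀ i j, (P i : Space d) j = ((i j : ℕ) : ℝ) / N := fun _ _ => rfl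
  let W : (Fin d → Fin (N + 1)) → Space d → ℝ := fun i x => ∏ j, hat (N * x j - (i j : ℕ))
  have hWP : ∀ i k, i ≠ k → W i (P k) = 0 := fun i k hik => by
    obtain ⟨j, hj⟩ := Function.ne_iff.1 hik
    refine Finset.prod_eq_zero (Finset.mem_univ j) ?_
    rw [hP, mul_div_cancel₀ _ hN0.ne', hat_natCast_sub, if_neg]
    exact fun h => hj (Fin.ext h.symm)
  refine ⟨_, inferInstance, P, W, fun i k hik => ?_, fun i => ?_,
    fun i x => Finset.prod_nonneg fun j _ => hat_nonneg _, fun x hx => ?_, fun x hx => ?_,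
    fun i x hW => ?_, hWP⟩
  · funext j
    have h := congrArg (fun y : cube d => (y : Space d) j) hik
    simp only [hP] at h
    rw [div_left_inj' hN0.ne'] at h
    exact Fin.ext (by exact_mod_cast h)
  · exact continuous_finsetProd _ fun j _ => continuous_hat.comp (by fun_prop)
  · have := Finset.prod_univ_sum (fun _ : Fin d => (Finset.univ : Finset (Fin (N + 1))))
      (fun j k => hat (N * x j - (k : ℕ)))
    rw [Fintype.piFinset_univ] at this
    rw [← this]
    exact Finset.prod_eq_one fun j _ => (sum_fin_hat N (hmul x hx j)).1
  · ext l
    -- Inserting the node coordinate in the `l`-th factor alone makes the product of sums equal to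
    -- the `l`-th coordinate of the barycentre.
    have := Finset.prod_univ_sum (fun _ : Fin d => (Finset.univ : Finset (Fin (N + 1))))
      (fun j k => hat (N * x j - (k : ℕ)) * if j = l then ((k : ℕ) : ℝ) / N else 1)
    rw [Fintype.piFinset_univ] at this
    have h1 : ∀ i : Fin d → Fin (N + 1), ∏ j, (hat (N * x j - (i j : ℕ)) *
        if j = l then ((i j : ℕ) : ℝ) / N else 1) = W i x * (P i : Space d) l := fun i => by
      rw [Finset.prod_mul_distrib, Finset.prod_ite_eq' Finset.univ l, if_pos (Finset.mem_univ l)]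
    simp only [h1] at this
    simp only [WithLp.ofLp_sum, WithLp.ofLp_smul, Finset.sum_apply, Pi.smul_apply, smul_eq_mul]
    rw [← this, Finset.prod_eq_single l]
    · simp only [if_true, ← mul_div_assoc, ← Finset.sum_div]
      rw [(sum_fin_hat N (hmul x hx l)).2, mul_div_cancel_left₀ _ hN0.ne']
    · intro j _ hj
      simp only [if_neg hj, mul_one]
      exact (sum_fin_hat N (hmul x hx j)).1
    · simp
  · rw [dist_eq_norm]
    refine (norm_le_sum_abs _).trans_lt ?_
    have h1 : ∀ j, |((P i : Space d) - x) j| ≤ 1 / N := fun j => by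
      have h2 : hat (N * x j - (i j : ℕ)) ≠ 0 := Finset.prod_ne_zero_iff.1 hW j (Finset.mem_univ j)
      have h3 : |N * x j - (i j : ℕ)| ≤ 1 := by
        by_contra h
        exact h2 (hat_eq_zero (not_le.1 h).le)
      rw [PiLp.sub_apply, hP, le_div_iff₀ hN0, ← abs_of_pos hN0, ← abs_mul, abs_of_pos hN0, sub_mul,
        div_mul_cancel₀ _ hN0.ne', abs_sub_comm, mul_comm]
      exact h3
    calc ∑ j, |((P i : Space d) - x) j| ≤ ∑ _j : Fin d, 1 / (N : ℝ) :=
          Finset.sum_le_sum fun j _ => h1 j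
      _ = d / N := by simp [div_eq_mul_inv]
      _ < δ := by
        rw [div_lt_iff₀ hδ] at hN
        rw [div_lt_iff₀ hN0]
        linarith

/-! ### Data in general position -/

variable {d : ℕ}

/-- An affine dependence among the nodes of `S` gives a functional that kills all data affine on
`S`. Its kernel is a proper closed subspace, so its complement is open and dense, and only finitely
many `S` occur. -/
theorem dense_affine_contact_independent {ι : Type} [Fintype ι] {P : ι → cube d}
    (hP : Function.Injective P) :
    Dense {f : C(cube d, ℝ) | ∀ S : Finset ι,
      (∃ (p : Space d) (c : ℝ), ∀ i ∈ S, f (P i) = inner ℝ p (P i : Space d) + c) →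
      AffineIndependent ℝ fun i : S => (P i : Space d)} := by
  refine dense_of_mem_residual (X := C(cube d, ℝ)) ?_
  refine (eventually_countable_forall (ι := Finset ι)).2 fun S => ?_
  by_cases hS : AffineIndependent ℝ fun i : S => (P i : Space d)
  · exact Eventually.of_forall fun f _ => hS
  rw [affineIndependent_iff] at hS
  push Not at hS
  obtain ⟨t, w, hw0, hw1, e₀, he₀, hwe⟩ := hS
  let Λ : C(cube d, ℝ) →L[ℝ] ℝ := ∑ e ∈ t, w e • ContinuousMap.evalCLM ℝ (P e)
  have hΛ : ∀ f, Λ f = ∑ e ∈ t, w e * f (P e) := fun f => by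
    simp [Λ]
  have hopen : IsOpen {f | Λ f ≠ 0} := isOpen_ne.preimage Λ.continuous
  have hdense : Dense {f | Λ f ≠ 0} := by
    have : {f | Λ f ≠ 0} = ((LinearMap.ker Λ.toLinearMap : Submodule ℝ C(cube d, ℝ)) :
        Set C(cube d, ℝ))ᶜ := by
      ext f; simp
    rw [this, ← interior_eq_empty_iff_dense_compl, ← not_nonempty_iff_eq_empty]
    intro hne
    have htop := Submodule.eq_top_of_nonempty_interior' _ hne
    -- A function equal to 1 at the node `e₀` and to 0 at the other nodes of `S` shows that `Λ` is
    -- nonzero.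
    obtain ⟨h, h0, h1, -⟩ := exists_continuous_zero_one_of_isClosed
      (s := (fun e : S => P e) '' {e | e ≠ e₀}) (t := {P e₀})
      ((Set.toFinite _).isClosed) isClosed_singleton (by
        rw [disjoint_singleton_right]
        rintro ⟨e, he, hPe⟩
        exact he (Subtype.ext (hP hPe)))
    have h2 : Λ h = 0 := by
      have : h ∈ LinearMap.ker Λ.toLinearMap := htop ▸ Submodule.mem_top
      exact this
    rw [hΛ, Finset.sum_eq_single_of_mem e₀ he₀, h1 (mem_singleton _)] at h2
    · simp at h2; exact hwe h2
    · intro e _ hne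
      rw [h0 (mem_image_of_mem _ hne)]; simp
  refine mem_of_superset (residual_of_dense_open hopen hdense) ?_
  rintro f hf ⟨p, c, hpc⟩
  refine absurd ?_ hf
  rw [hΛ]
  calc ∑ e ∈ t, w e * f (P e) = ∑ e ∈ t, w e * (inner ℝ p (P e : Space d) + c) :=
        Finset.sum_congr rfl fun e _ => by rw [hpc e e.2]
    _ = inner ℝ p (∑ e ∈ t, w e • (P e : Space d)) + (∑ e ∈ t, w e) * c := by
        simp only [mul_add, Finset.sum_add_distrib, Finset.sum_mul, inner_sum,
          real_inner_smul_right]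
    _ = 0 := by rw [hw0, hw1]; simp

/-- `f` is approximated by functions lying, with a gap, below the envelope of their restriction
to a finite set of points, on which they are in general position. -/
theorem exists_polyhedral_near (f : C(cube d, ℝ)) {ε : ℝ} (hε : 0 < ε) :
    ∃ g : C(cube d, ℝ), dist g f < ε ∧
      ∃ (ι : Type) (_ : Fintype ι) (P : ι → cube d), ∃ κ > (0 : ℝ),
      (∀ x : cube d, ∃ w : ι → ℝ, (∀ i, 0 ≤ w i) ∧ ∑ i, w i = 1 ∧
        ∑ i, w i • (P i : Space d) = x ∧
        ∃ k, g x + κ * min 1 (dist (x : Space d) (P k)) ≤ ∑ i, w i * g (P i)) ∧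
      (∀ S : Finset ι, (∃ (p : Space d) (c : ℝ), ∀ i ∈ S, g (P i) = inner ℝ p (P i : Space d) + c) →
        AffineIndependent ℝ fun i : S => (P i : Space d)) := by
  obtain ⟨δ, hδ, hmod⟩ := exists_modulus f (ε := ε / 8) (by positivity)
  obtain ⟨ι, _, P, W, hP, hWc, hW0, hW1, hWx, hWd, hWP⟩ := exists_barycentric_partition d hδ
  obtain ⟨f₁, hf₁, hgen⟩ := Metric.dense_iff.1 (dense_affine_contact_independent hP) f (ε / 8)
    (by positivity)
  have hne : (range fun i => (P i : Space d)).Nonempty := by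
    by_contra h
    rw [not_nonempty_iff_eq_empty, range_eq_empty_iff] at h
    simpa using hW1 0 (zero_mem_cube d)
  let u : cube d → ℝ := fun x => ∑ i, W i x * f₁ (P i)
  have huc : Continuous u := by
    refine continuous_finsetSum _ fun i _ => ?_
    exact ((hWc i).comp continuous_subtype_val).mul continuous_const
  let D : cube d → ℝ := fun x => Metric.infDist (x : Space d) (range fun i => (P i : Space d))
  have hDc : Continuous D := (Metric.continuous_infDist_pt _).comp continuous_subtype_val
  -- The subtracted term vanishes exactly at the nodes: the nodal data remain those of `f₁`, and
  -- elsewhere there is a gap below the interpolant `u`.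
  let g : C(cube d, ℝ) := ⟨fun x => u x - ε / 4 * min 1 (D x), by fun_prop⟩
  have hg : ∀ x, g x = u x - ε / 4 * min 1 (D x) := fun _ => rfl
  have huP : ∀ k, u (P k) = f₁ (P k) := fun k => by
    have h1 := hW1 (P k) (P k).2
    rw [Finset.sum_eq_single_of_mem k (Finset.mem_univ k) fun i _ hi => hWP i k hi] at h1
    simp only [u]
    rw [Finset.sum_eq_single_of_mem k (Finset.mem_univ k) fun i _ hi => by
      rw [hWP i k hi, zero_mul], h1, one_mul]
  have hgP : ∀ k, g (P k) = f₁ (P k) := fun k => by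
    have : D (P k) = 0 := Metric.infDist_zero_of_mem (mem_range_self k)
    rw [hg, huP, this]; simp
  refine ⟨g, ?_, ι, inferInstance, P, ε / 4, by positivity, fun x => ?_, fun S => ?_⟩
  · rw [ContinuousMap.dist_lt_iff hε]
    intro x
    have hf₁' : ∀ y, |f₁ y - f y| ≤ ε / 8 := abs_sub_le_of_mem_ball hf₁
    have h1 : |u x - f x| ≤ ε / 4 := by
      have h2 : u x - f x = ∑ i, W i x * (f₁ (P i) - f x) := by
        simp only [mul_sub, Finset.sum_sub_distrib, ← Finset.sum_mul, hW1 x x.2, one_mul, u]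
      rw [h2]
      calc |∑ i, W i x * (f₁ (P i) - f x)| ≤ ∑ i, |W i x * (f₁ (P i) - f x)| :=
            Finset.abs_sum_le_sum_abs _ _
        _ ≤ ∑ i, W i x * (ε / 4) := by
            refine Finset.sum_le_sum fun i _ => ?_
            rw [abs_mul, abs_of_nonneg (hW0 i x)]
            by_cases hi : W i x = 0
            · simp [hi]
            · refine mul_le_mul_of_nonneg_left ?_ (hW0 i x)
              have h3 := abs_le.1 (hf₁' (P i))
              have h4 := abs_lt.1 (hmod (P i) x (hWd i x hi))
              rw [abs_le]
              constructor <;> linarith [h3.1, h3.2, h4.1, h4.2]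
        _ = ε / 4 := by rw [← Finset.sum_mul, hW1 x x.2, one_mul]
    have h5 : 0 ≤ min 1 (D x) := le_min zero_le_one Metric.infDist_nonneg
    have h6 : min 1 (D x) ≤ 1 := min_le_left _ _
    rw [Real.dist_eq, hg]
    rw [abs_le] at h1
    rw [abs_lt]
    constructor <;> nlinarith [h1.1, h1.2]
  · refine ⟨fun i => W i x, fun i => hW0 i x, hW1 x x.2, hWx x x.2, ?_⟩
    obtain ⟨_, ⟨k, rfl⟩, hk⟩ :=
      (Set.finite_range fun i => (P i : Space d)).isCompact.exists_infDist_eq_dist hne (x : Space d)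
    refine ⟨k, ?_⟩
    rw [← hk, hg]
    simp only [hgP]
    simp [u, D]
  · simp only [hgP]
    exact hgen S

end ConvexHullGraph

namespace ConvexHullGraph

variable {d : ℕ}

/-! ### Residual properties: small contact sets and sharp ridges -/

/-- `x` is a convex combination of `d` points of the cube at which an affine majorant of `f`
touches `f`. -/
def LowRep (f : C(cube d, ℝ)) (x : Space d) : Prop :=
  ∃ (p : Space d) (c : ℝ) (z : Fin d → cube d) (w : Fin d → ℝ),
    (∀ y : cube d, f y ≤ inner ℝ p y + c) ∧ (∀ k, 0 ≤ w k) ∧ ∑ k, w k = 1 ∧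
    ∑ k, w k • (z k : Space d) = x ∧ ∀ k, f (z k) = inner ℝ p (z k : Space d) + c

/-- The contact set is covered by few balls of the same small radius. -/
def ThinContact (n : ℕ) (f : C(cube d, ℝ)) : Prop :=
  ∃ (ι : Type) (_ : Fintype ι) (P : ι → cube d) (r : ℝ), 0 < r ∧ r < 1 / (n + 1) ∧
    (∀ x ∈ contactSet 1 f, ∃ i, dist x (P i) < r) ∧
    Fintype.card ι * r ^ (1 / ((n : ℝ) + 1)) ≤ 1 / (n + 1)

/-- Near the points with a low representation, the upper envelope has very negative second
differences at some small scale. -/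
def SharpRidges (n : ℕ) (f : C(cube d, ℝ)) : Prop :=
  ∃ ρ : ℝ, 0 < ρ ∧ 2 * ρ < 1 / (n + 1) ∧
    ∀ x, Metric.closedBall x (1 / ((n : ℝ) + 1)) ⊆ cube d → LowRep f x →
      ∃ z u : Space d, ‖z - x‖ ≤ ρ ∧ ‖u‖ = 1 ∧
        envelope 1 f (z + ρ • u) + envelope 1 f (z - ρ • u) - 2 * envelope 1 f z ≤
          -((n + 1) * ρ ^ (1 + 1 / ((n : ℝ) + 1)))

/-- Extend `s` to an affine basis. It has `d + 1` points, so one of them is missed by the `d` points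
`t k`; take its barycentric coordinate. -/
theorem exists_affine_vanishing_nonneg (hd : 0 < d) {s : Set (Space d)}
    (hs : AffineIndependent ℝ fun x : s => (x : Space d)) {t : Fin d → Space d}
    (ht : ∀ k, t k ∈ s) :
    ∃ (q : Space d) (b : ℝ), q ≠ 0 ∧ (∀ k, inner ℝ q (t k) + b = 0) ∧
      ∀ x ∈ s, 0 ≤ inner ℝ q x + b := by
  obtain ⟨s', hss', hind, hspan⟩ := exists_subset_affineIndependent_affineSpan_eq_top hs
  have hfin : Finite s' := finite_of_fin_dim_affineIndependent ℝ hind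
  have := Fintype.ofFinite s'
  let B : AffineBasis s' ℝ (Space d) := ⟨fun x => x, hind, by simpa using hspan⟩
  have hcard : Fintype.card s' = d + 1 := by
    rw [B.card_eq_finrank_add_one]; simp
  obtain ⟨b₀, hb₀⟩ : ∃ b₀ : s', ∀ k, t k ≠ b₀ := by
    by_contra! h
    have hsurj : Function.Surjective fun k => (⟨t k, hss' (ht k)⟩ : s') := fun b => by
      obtain ⟨k, hk⟩ := h b
      exact ⟨k, Subtype.ext hk⟩
    have := Fintype.card_le_of_surjective _ hsurj
    simp [hcard] at this
  let a := B.coord b₀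
  have hB : ∀ y : s', B y = y := fun _ => rfl
  have ha0 : ∀ y : s', y ≠ b₀ → a y = 0 := fun y hy => by
    rw [← hB]; exact B.coord_apply_ne hy.symm
  have ha1 : a b₀ = 1 := by
    rw [← hB]; exact B.coord_apply_eq b₀
  let q := (InnerProductSpace.toDual ℝ (Space d)).symm a.linear.toContinuousLinearMap
  have hq : ∀ y, inner ℝ q y + a 0 = a y := fun y => by
    rw [InnerProductSpace.toDual_symm_apply]
    have := a.map_vadd 0 y
    simpa using this.symm
  have hat : ∀ k, a (t k) = 0 := fun k =>
    ha0 ⟨t k, hss' (ht k)⟩ fun h => hb₀ k (congrArg Subtype.val h)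
  refine ⟨q, a 0, fun h => ?_, fun k => by rw [hq, hat], fun x hx => ?_⟩
  · have h1 := hq (t ⟨0, hd⟩)
    have h2 := hq b₀
    rw [h, inner_zero_left, hat] at h1
    rw [h, inner_zero_left, ha1] at h2
    linarith
  · rw [hq]
    by_cases hxb : (⟨x, hss' hx⟩ : s') = b₀
    · have : a x = 1 := by rw [← ha1, ← hxb]
      rw [this]; exact zero_le_one
    · exact (ha0 ⟨x, hss' hx⟩ hxb).ge

variable {f g : C(cube d, ℝ)} {ι : Type} [Fintype ι] {P : ι → cube d}

/-- The nodes touched by the majorant are affinely independent, so some nonconstant affine function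
is nonnegative on them and zero at the nodes `T k`. A small positive multiple may be added, since
the inequalities at the other nodes are strict. -/
theorem exists_tilted_majorant (hd : 0 < d)
    (hgen : ∀ S : Finset ι,
      (∃ (p : Space d) (c : ℝ), ∀ i ∈ S, g (P i) = inner ℝ p (P i : Space d) + c) →
      AffineIndependent ℝ fun i : S => (P i : Space d))
    {p : Space d} {c : ℝ} (hmaj : ∀ i, g (P i) ≤ inner ℝ p (P i : Space d) + c) {T : Fin d → ι}
    (hT : ∀ k, g (P (T k)) = inner ℝ p (P (T k) : Space d) + c) :
    ∃ (p' : Space d) (c' : ℝ), p' ≠ p ∧ (∀ i, g (P i) ≤ inner ℝ p' (P i : Space d) + c') ∧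
      ∀ k, g (P (T k)) = inner ℝ p' (P (T k) : Space d) + c' := by
  classical
  let S : Finset ι := Finset.univ.filter fun i => g (P i) = inner ℝ p (P i : Space d) + c
  have hS : ∀ i, i ∈ S ↔ g (P i) = inner ℝ p (P i : Space d) + c := fun i => by simp [S]
  have hind := (hgen S ⟨p, c, fun i hi => (hS i).1 hi⟩).range
  obtain ⟨q, b, hq, hqT, hqS⟩ := exists_affine_vanishing_nonneg hd hind
    (t := fun k => (P (T k) : Space d)) fun k => ⟨⟨T k, (hS _).2 (hT k)⟩, rfl⟩
  have hev : ∀ᶠ τ in 𝓝[>] (0 : ℝ), ∀ i,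
      g (P i) ≤ inner ℝ p (P i : Space d) + c + τ * (inner ℝ q (P i : Space d) + b) := by
    rw [eventually_all]
    intro i
    by_cases hi : i ∈ S
    · have h1 := hqS _ ⟨⟨i, hi⟩, rfl⟩
      filter_upwards [eventually_mem_nhdsWithin] with τ hτ
      rw [(hS i).1 hi]
      exact le_add_of_nonneg_right (mul_nonneg (le_of_lt hτ) h1)
    · have h1 : g (P i) < inner ℝ p (P i : Space d) + c :=
        lt_of_le_of_ne (hmaj i) fun h => hi ((hS i).2 h)
      have h2 : Tendsto (fun τ : ℝ => inner ℝ p (P i : Space d) + c +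
          τ * (inner ℝ q (P i : Space d) + b)) (𝓝[>] 0) (𝓝 (inner ℝ p (P i : Space d) + c +
          0 * (inner ℝ q (P i : Space d) + b))) :=
        (Continuous.tendsto (by fun_prop) _).mono_left nhdsWithin_le_nhds
      rw [zero_mul, add_zero] at h2
      filter_upwards [h2.eventually_const_lt h1] with τ hτ using hτ.le
  obtain ⟨τ, hτ, hτ0⟩ := (hev.and eventually_mem_nhdsWithin).exists
  have hsplit : ∀ y : Space d, inner ℝ (p + τ • q) y + (c + τ * b) =
      inner ℝ p y + c + τ * (inner ℝ q y + b) := fun y => by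
    rw [inner_add_left, real_inner_smul_left]; ring
  refine ⟨p + τ • q, c + τ * b, ?_, fun i => ?_, fun k => ?_⟩
  · have : (0 : ℝ) < τ := hτ0
    simp [this.ne', hq]
  · rw [hsplit]; exact hτ i
  · rw [hsplit, hqT, mul_zero, add_zero, hT]

/-- A common touching simplex of approximate majorants is shared by two well separated exact
majorants. -/
def TwoMajorants (g : C(cube d, ℝ)) (P : ι → cube d) (R : ℝ) (T : Fin d → ι) (τ : ℝ) : Prop :=
  ∀ (p : Space d) (c : ℝ), ‖p‖ ≤ R → |c| ≤ R →
    (∀ i, g (P i) - τ ≤ inner ℝ p (P i : Space d) + c) →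
    (∀ k, inner ℝ p (P (T k) : Space d) + c ≤ g (P (T k)) + τ) →
    ∃ (p₁ p₂ : Space d) (c₁ c₂ : ℝ), τ ≤ ‖p₁ - p₂‖ ∧
      (∀ i, g (P i) ≤ inner ℝ p₁ (P i : Space d) + c₁) ∧
      (∀ i, g (P i) ≤ inner ℝ p₂ (P i : Space d) + c₂) ∧
      (∀ k, g (P (T k)) = inner ℝ p₁ (P (T k) : Space d) + c₁) ∧
      (∀ k, g (P (T k)) = inner ℝ p₂ (P (T k) : Space d) + c₂)

/-- Either an exact majorant touches at all the nodes `T k`, and tilting it provides the second one,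
or none does. In the latter case compactness bounds the defect of all candidates below, and the
condition is vacuous for small `τ`. -/
theorem eventually_twoMajorants (hd : 0 < d)
    (hgen : ∀ S : Finset ι,
      (∃ (p : Space d) (c : ℝ), ∀ i ∈ S, g (P i) = inner ℝ p (P i : Space d) + c) →
      AffineIndependent ℝ fun i : S => (P i : Space d)) {R : ℝ} (hR : 0 ≤ R) (T : Fin d → ι) :
    ∀ᶠ τ in 𝓝[>] (0 : ℝ), TwoMajorants g P R T τ := by
  by_cases h : ∃ (p : Space d) (c : ℝ), (∀ i, g (P i) ≤ inner ℝ p (P i : Space d) + c) ∧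
      ∀ k, g (P (T k)) = inner ℝ p (P (T k) : Space d) + c
  · obtain ⟨p, c, hmaj, hT⟩ := h
    obtain ⟨p', c', hne, hmaj', hT'⟩ := exists_tilted_majorant hd hgen hmaj hT
    filter_upwards [eventually_lt_nhdsGT_zero (norm_pos_iff.2 (sub_ne_zero.2 hne))] with τ hτ
    exact fun _ _ _ _ _ _ => ⟨p', p, c', c, hτ.le, hmaj', hmaj, hT', hT⟩
  -- The total defect: it vanishes exactly at majorants touching at all the nodes `T k`.
  · let m : Space d × ℝ → ℝ := fun a =>
      ∑ i, max 0 (g (P i) - (inner ℝ a.1 (P i : Space d) + a.2)) +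
      ∑ k, max 0 (inner ℝ a.1 (P (T k) : Space d) + a.2 - g (P (T k)))
    have hm : Continuous m := by fun_prop
    have hmpos : ∀ a, 0 < m a := fun a => by
      have h1 : 0 ≤ ∑ i, max 0 (g (P i) - (inner ℝ a.1 (P i : Space d) + a.2)) :=
        Finset.sum_nonneg fun _ _ => le_max_left _ _
      have h2 : 0 ≤ ∑ k, max 0 (inner ℝ a.1 (P (T k) : Space d) + a.2 - g (P (T k))) :=
        Finset.sum_nonneg fun _ _ => le_max_left _ _
      refine lt_of_le_of_ne (add_nonneg h1 h2) fun h0 => h ?_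
      obtain ⟨h3, h4⟩ := (add_eq_zero_iff_of_nonneg h1 h2).1 h0.symm
      rw [Finset.sum_eq_zero_iff_of_nonneg fun _ _ => le_max_left _ _] at h3 h4
      have h5 : ∀ i, g (P i) ≤ inner ℝ a.1 (P i : Space d) + a.2 := fun i => by
        have := max_eq_left_iff.1 (h3 i (Finset.mem_univ i)); linarith
      refine ⟨a.1, a.2, h5, fun k => le_antisymm (h5 _) ?_⟩
      have := max_eq_left_iff.1 (h4 k (Finset.mem_univ k)); linarith
    obtain ⟨a₀, -, ha₀⟩ := ((isCompact_closedBall (0 : Space d) R).prod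
      (isCompact_closedBall (0 : ℝ) R)).exists_isMinOn
      ⟨(0, 0), by simp [hR]⟩ hm.continuousOn
    have hlim : Tendsto (fun τ : ℝ => Fintype.card ι * τ + d * τ) (𝓝[>] 0) (𝓝 0) := by
      have : Tendsto (fun τ : ℝ => Fintype.card ι * τ + d * τ) (𝓝 0)
        (𝓝 (Fintype.card ι * 0 + d * 0)) := Continuous.tendsto (by fun_prop) _
      simpa using this.mono_left nhdsWithin_le_nhds
    filter_upwards [hlim.eventually_lt_const (hmpos a₀), eventually_mem_nhdsWithin] with τ hτ hτ0
    intro p c hp hc h1 h2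
    have hτ0' : 0 ≤ τ := le_of_lt hτ0
    have h3 : m a₀ ≤ m (p, c) := ha₀ ⟨by simpa using hp, by simpa using hc⟩
    have h4 : m (p, c) ≤ Fintype.card ι * τ + d * τ := by
      refine add_le_add ?_ ?_
      · refine (Finset.sum_le_sum fun i _ => max_le hτ0' (?_ : _ ≤ τ)).trans (by simp)
        simp only; linarith [h1 i]
      · refine (Finset.sum_le_sum fun k _ => max_le hτ0' (?_ : _ ≤ τ)).trans (by simp)
        simp only; linarith [h2 k]
    linarith

/-- The envelope lies below the minimum of two affine functions that it meets at `x`; each end of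
the segment is bounded by the function that is lower on its side. -/
theorem second_difference_le {p₁ p₂ : Space d} {c₁ c₂ : ℝ} (hne : p₁ ≠ p₂)
    (h₁ : ∀ y : cube d, g y ≤ inner ℝ p₁ y + c₁) (h₂ : ∀ y : cube d, g y ≤ inner ℝ p₂ y + c₂)
    {x : Space d} {ρ : ℝ} (hx₁ : inner ℝ p₁ x + c₁ ≤ envelope 1 g x)
    (hx₂ : inner ℝ p₂ x + c₂ ≤ envelope 1 g x)
    (hplus : x + ρ • (‖p₁ - p₂‖⁻¹ • (p₁ - p₂)) ∈ cube d)
    (hminus : x - ρ • (‖p₁ - p₂‖⁻¹ • (p₁ - p₂)) ∈ cube d) :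
    envelope 1 g (x + ρ • (‖p₁ - p₂‖⁻¹ • (p₁ - p₂))) +
      envelope 1 g (x - ρ • (‖p₁ - p₂‖⁻¹ • (p₁ - p₂))) - 2 * envelope 1 g x ≤
      -(ρ * ‖p₁ - p₂‖) := by
  have hpos : 0 < ‖p₁ - p₂‖ := norm_pos_iff.2 (sub_ne_zero.2 hne)
  have e₂ := envelope_le_of_majorant h₂ hplus
  have e₁ := envelope_le_of_majorant h₁ hminus
  have h3 : inner ℝ p₁ (p₁ - p₂) - inner ℝ p₂ (p₁ - p₂) = ‖p₁ - p₂‖ ^ 2 := by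
    rw [← inner_sub_left, real_inner_self_eq_norm_sq]
  rw [inner_add_right, real_inner_smul_right, real_inner_smul_right] at e₂
  rw [inner_sub_right, real_inner_smul_right, real_inner_smul_right] at e₁
  have h4 : ρ * (‖p₁ - p₂‖⁻¹ * inner ℝ p₁ (p₁ - p₂)) - ρ * (‖p₁ - p₂‖⁻¹ * inner ℝ p₂ (p₁ - p₂)) =
      ρ * ‖p₁ - p₂‖ := by
    rw [← mul_sub, ← mul_sub, h3]
    field_simp
  linarith

theorem majorant_of_majorant_on_points
    (hbar : ∀ x : cube d, ∃ w : ι → ℝ, (∀ i, 0 ≤ w i) ∧ ∑ i, w i = 1 ∧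
      ∑ i, w i • (P i : Space d) = x ∧ g x ≤ ∑ i, w i * g (P i))
    {p : Space d} {c : ℝ} (h : ∀ i, g (P i) ≤ inner ℝ p (P i : Space d) + c) (y : cube d) :
    g y ≤ inner ℝ p (y : Space d) + c := by
  obtain ⟨w, hw, h1, hsum, hle⟩ := hbar y
  calc g y ≤ ∑ i, w i * g (P i) := hle
    _ ≤ ∑ i, w i * (inner ℝ p (P i : Space d) + c) :=
        Finset.sum_le_sum fun i _ => mul_le_mul_of_nonneg_left (h i) (hw i)
    _ = _ := by
        rw [← hsum, inner_sum]
        simp only [mul_add, Finset.sum_add_distrib, ← Finset.sum_mul, h1, one_mul,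
          real_inner_smul_right]

theorem norm_sum_smul_sub_le {α : Type*} [Fintype α] {w : α → ℝ} (hw : ∀ k, 0 ≤ w k)
    (h1 : ∑ k, w k = 1) {y z : α → Space d} {r : ℝ} (h : ∀ k, ‖y k - z k‖ ≤ r) :
    ‖∑ k, w k • y k - ∑ k, w k • z k‖ ≤ r := by
  rw [← Finset.sum_sub_distrib]
  calc ‖∑ k, (w k • y k - w k • z k)‖ ≤ ∑ k, ‖w k • y k - w k • z k‖ := norm_sum_le _ _
    _ ≤ ∑ k, w k * r := Finset.sum_le_sum fun k _ => by
        rw [← smul_sub, norm_smul, Real.norm_of_nonneg (hw k)]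
        exact mul_le_mul_of_nonneg_left (h k) (hw k)
    _ = r := by rw [← Finset.sum_mul, h1, one_mul]

/-- At a contact point `f` dominates the interpolation of its own nodal values, whereas `g` lies
below its interpolation by the gap; so the gap is at most `2 * η`. -/
theorem exists_dist_lt_of_mem_contactSet {κ η r : ℝ} (hκ : 0 < κ) (hr : r ≤ 1) (hη : 2 * η < κ * r)
    (hbar : ∀ x : cube d, ∃ w : ι → ℝ, (∀ i, 0 ≤ w i) ∧ ∑ i, w i = 1 ∧
      ∑ i, w i • (P i : Space d) = x ∧
      ∃ k, g x + κ * min 1 (dist (x : Space d) (P k)) ≤ ∑ i, w i * g (P i))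
    (hf : ∀ y, |f y - g y| ≤ η) {x : Space d} (hx : x ∈ contactSet 1 f) :
    ∃ i, dist x (P i) < r := by
  obtain ⟨hxc, hx⟩ := hx
  obtain ⟨w, hw, h1, hsum, k, hk⟩ := hbar ⟨x, hxc⟩
  refine ⟨k, ?_⟩
  have h2 := sum_le_envelope (f := f) hw h1 hsum
  have h3 : ∑ i, w i * g (P i) ≤ ∑ i, w i * f (P i) + η := by
    calc ∑ i, w i * g (P i) ≤ ∑ i, w i * (f (P i) + η) := Finset.sum_le_sum fun i _ =>
          mul_le_mul_of_nonneg_left (by linarith [(abs_le.1 (hf (P i))).1]) (hw i)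
      _ = _ := by simp only [mul_add, Finset.sum_add_distrib, ← Finset.sum_mul, h1, one_mul]
  have h4 := (abs_le.1 (hf ⟨x, hxc⟩)).2
  simp only at h2 hk
  rw [hx] at h2
  have h5 : κ * min 1 (dist x (P k)) < κ * r := by linarith
  have h6 := lt_of_mul_lt_mul_left h5 hκ.le
  rcases min_lt_iff.1 h6 with h | h
  · linarith
  · exact h

theorem thinContact_and_sharpRidges_mem_residual (hd : 0 < d) (n : ℕ) :
    {f : C(cube d, ℝ) | ThinContact n f ∧ SharpRidges n f} ∈ residual C(cube d, ℝ) := by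
  refine mem_residual_of_exists_ball fun f₀ ε hε => ?_
  obtain ⟨g, hg, ι, _, P, κ, hκ, hbar, hgen⟩ := exists_polyhedral_near f₀ hε
  refine ⟨g, hg, ?_⟩
  have hN : (0 : ℝ) < n + 1 := by positivity
  have hN1 : (1 : ℝ) / (n + 1) ≤ 1 := by
    rw [div_le_one hN]; linarith [n.cast_nonneg (α := ℝ)]
  set N : ℝ := n + 1
  set M : ℝ := ‖g‖ + 1
  have hM : 0 < M := by positivity
  -- Bounds both the slope and the constant term of any majorant touching the envelope at a point at
  -- depth `1 / N`, points of the cube having norm at most `d`.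
  set R : ℝ := 2 * M / (1 / N) * (d + 1) + M
  have hR : 0 ≤ R := by positivity
  obtain ⟨τ, hτ, hτ0⟩ := ((eventually_all.2 fun T => eventually_twoMajorants hd hgen hR T).and
    eventually_mem_nhdsWithin).exists
  replace hτ0 : 0 < τ := hτ0
  obtain ⟨δ, hδ, hmod⟩ := exists_modulus g (ε := τ / 4) (by positivity)
  -- The crease of slope gap `τ` yields `ρ * τ`, which exceeds `2 * N * ρ ^ (1 + 1 / N)`; half of
  -- this surplus is later spent on replacing `g` by `f`. The cover radius `r` and then the
  -- perturbation size `η` are chosen after `ρ`.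
  obtain ⟨ρ, hρ0, hρ1, hρ2⟩ := ((eventually_mem_nhdsWithin (a := (0 : ℝ)) (s := Ioi 0)).and
    ((eventually_lt_nhdsGT_zero (ε := 1 / N / 2) (by positivity)).and
    (eventually_mul_rpow_lt (s := 1 / N) (by positivity) (2 * N) hτ0))).exists
  replace hρ0 : 0 < ρ := hρ0
  obtain ⟨r, hr0, hr1, hr2, hr3, hr4, hr5⟩ :=
    ((eventually_mem_nhdsWithin (a := (0 : ℝ)) (s := Ioi 0)).and
    ((eventually_lt_nhdsGT_zero (ε := 1 / N) (by positivity)).and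
    ((eventually_lt_nhdsGT_zero hρ0).and
    ((eventually_lt_nhdsGT_zero hδ).and
    ((eventually_lt_nhdsGT_zero (ε := τ / 4 / (R + 1)) (by positivity)).and
    (eventually_mul_rpow_lt (s := 1 / N) (by positivity) (Fintype.card ι)
      (ε := 1 / N) (by positivity))))))).exists
  replace hr0 : 0 < r := hr0
  have hpow : 0 < N * ρ ^ (1 + 1 / N) := by positivity
  obtain ⟨η, hη0, hη1, hη2, hη3, hη4⟩ :=
    ((eventually_mem_nhdsWithin (a := (0 : ℝ)) (s := Ioi 0)).and
    ((eventually_lt_nhdsGT_zero (ε := τ / 4) (by positivity)).and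
    ((eventually_lt_nhdsGT_zero (ε := κ * r / 2) (by positivity)).and
    ((eventually_lt_nhdsGT_zero (ε := N * ρ ^ (1 + 1 / N) / 4) (by positivity)).and
    (eventually_lt_nhdsGT_zero one_pos))))).exists
  refine ⟨η, hη0, fun f hf => ?_⟩
  have hfg : ∀ y, |f y - g y| ≤ η := abs_sub_le_of_mem_ball hf
  have hcontact : ∀ x ∈ contactSet 1 f, ∃ i, dist x (P i) < r := fun x hx =>
    exists_dist_lt_of_mem_contactSet hκ (hr1.le.trans hN1) (by linarith) hbar hfg hx
  refine ⟨⟨ι, inferInstance, P, r, hr0, hr1, hcontact, hr5.le⟩, ρ, hρ0, by linarith, ?_⟩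
  rintro x hx ⟨p, c, z, w, hmaj, hw, h1, hsum, hz⟩
  have hfM : ∀ y, |f y| ≤ M := fun y => by
    have := abs_le.1 (hfg y)
    have h2 := abs_le.1 (g.norm_coe_le_norm y)
    rw [abs_le]
    constructor <;> linarith [this.1, this.2, h2.1, h2.2]
  have hxc : x ∈ cube d := hx (Metric.mem_closedBall_self (by positivity))
  have hval : inner ℝ p x + c = ∑ k, w k * f (z k) := by
    simp only [hz, mul_add, Finset.sum_add_distrib, ← Finset.sum_mul, h1, one_mul, ← hsum,
      inner_sum, real_inner_smul_right]
  have habs : |inner ℝ p x + c| ≤ M := by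
    rw [hval]
    calc |∑ k, w k * f (z k)| ≤ ∑ k, |w k * f (z k)| := Finset.abs_sum_le_sum_abs _ _
      _ ≤ ∑ k, w k * M := Finset.sum_le_sum fun k _ => by
          rw [abs_mul, abs_of_nonneg (hw k)]
          exact mul_le_mul_of_nonneg_left (hfM _) (hw k)
      _ = M := by rw [← Finset.sum_mul, h1, one_mul]
  have hp : ‖p‖ ≤ 2 * M / (1 / N) :=
    norm_le_of_majorant (by positivity) hfM hx hmaj (abs_le.1 habs).2
  have hpx : |inner ℝ p x| ≤ 2 * M / (1 / N) * d :=
    (abs_real_inner_le_norm p x).trans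
      (mul_le_mul hp (norm_le_of_mem_cube hxc) (norm_nonneg _) (by positivity))
  have hMN : 0 ≤ 2 * M / (1 / N) := by positivity
  have hMNd : 0 ≤ 2 * M / (1 / N) * d := by positivity
  have hpR : ‖p‖ ≤ R := by simp only [R]; linarith
  have hcR : |c| ≤ R := by
    rw [abs_le] at habs hpx ⊢
    constructor <;> simp only [R] <;> linarith [habs.1, habs.2, hpx.1, hpx.2]
  choose T hT using fun k => hcontact _ (mem_contactSet_of_majorant hmaj (hz k))
  -- The majorant of `f` is an approximate majorant of the nodal data of `g`; the error at the nodes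
  -- `T k` comes from the slope, the modulus of `g` and `η`, each at most `τ / 4`.
  obtain ⟨p₁, p₂, c₁, c₂, hsep, hmaj₁, hmaj₂, hT₁, hT₂⟩ := hτ T p c hpR hcR
    (fun i => by linarith [(abs_le.1 (hfg (P i))).1, hmaj (P i)])
    (fun k => by
      have h2 : inner ℝ p ((P (T k) : Space d) - z k) ≤ τ / 4 := by
        calc inner ℝ p ((P (T k) : Space d) - z k) ≤ ‖p‖ * ‖(P (T k) : Space d) - z k‖ :=
              real_inner_le_norm _ _
          _ ≤ R * r := by
              refine mul_le_mul hpR ?_ (norm_nonneg _) hR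
              rw [← dist_eq_norm, dist_comm]; exact (hT k).le
          _ ≤ τ / 4 := by
              rw [lt_div_iff₀ (by positivity)] at hr4
              linarith
      rw [inner_sub_right] at h2
      have h3 := (abs_lt.1 (hmod (z k) (P (T k)) ((hT k).trans hr3))).2
      have h4 := (abs_le.1 (hfg (z k))).2
      linarith [hz k])
  -- Replacing each touching point by its nearby node, with the same weights, moves `x` onto the
  -- crease of the envelope of `g`.
  set x' : Space d := ∑ k, w k • (P (T k) : Space d)
  have hxx' : ‖x' - x‖ ≤ r := by
    rw [← hsum]
    exact norm_sum_smul_sub_le hw h1 fun k => by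
      rw [← dist_eq_norm, dist_comm]; exact (hT k).le
  have hne : p₁ ≠ p₂ := fun h => by
    rw [h, sub_self, norm_zero] at hsep; linarith
  have hpos : 0 < ‖p₁ - p₂‖ := norm_pos_iff.2 (sub_ne_zero.2 hne)
  set u : Space d := ‖p₁ - p₂‖⁻¹ • (p₁ - p₂) with hu_def
  have hu : ‖u‖ = 1 := by
    rw [norm_smul, norm_inv, norm_norm, inv_mul_cancel₀ hpos.ne']
  have hmem : ∀ v : Space d, ‖v‖ ≤ ρ → x' + v ∈ cube d := fun v hv => hx (by
    rw [Metric.mem_closedBall, dist_eq_norm, add_sub_right_comm]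
    refine (norm_add_le _ _).trans ?_
    linarith)
  have hρu : ‖ρ • u‖ = ρ := by rw [norm_smul, hu, mul_one, Real.norm_of_nonneg hρ0.le]
  have hplus : x' + ρ • u ∈ cube d := hmem _ hρu.le
  have hminus : x' - ρ • u ∈ cube d := by
    rw [sub_eq_add_neg]; exact hmem _ (by rw [norm_neg, hρu])
  have hx'c : x' ∈ cube d := by simpa using hmem 0 (by simpa using hρ0.le)
  have hbar' : ∀ x : cube d, ∃ w : ι → ℝ, (∀ i, 0 ≤ w i) ∧ ∑ i, w i = 1 ∧
      ∑ i, w i • (P i : Space d) = x ∧ g x ≤ ∑ i, w i * g (P i) := fun x => by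
    obtain ⟨w, h1, h2, h3, k, h4⟩ := hbar x
    refine ⟨w, h1, h2, h3, le_trans (le_add_of_nonneg_right ?_) h4⟩
    positivity
  have hlow : ∀ (q : Space d) (b : ℝ), (∀ k, g (P (T k)) = inner ℝ q (P (T k) : Space d) + b) →
      inner ℝ q x' + b ≤ envelope 1 g x' := fun q b hq => by
    refine le_trans (le_of_eq ?_) (sum_le_envelope (f := g) (z := fun k => P (T k)) hw h1 rfl)
    simp only [hq, mul_add, Finset.sum_add_distrib, ← Finset.sum_mul, h1, one_mul, x',
      inner_sum, real_inner_smul_right]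
  have key := second_difference_le hne (majorant_of_majorant_on_points hbar' hmaj₁)
    (majorant_of_majorant_on_points hbar' hmaj₂) (hlow _ _ hT₁) (hlow _ _ hT₂) hplus hminus
  rw [← hu_def] at key
  refine ⟨x', u, hxx'.trans hr2.le, hu, ?_⟩
  have e1 := (abs_le.1 (abs_envelope_sub_le hfg hplus)).2
  have e2 := (abs_le.1 (abs_envelope_sub_le hfg hminus)).2
  have e3 := (abs_le.1 (abs_envelope_sub_le hfg hx'c)).1
  have e4 : 2 * (N * ρ ^ (1 + 1 / N)) ≤ ρ * ‖p₁ - p₂‖ := by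
    rw [Real.rpow_add hρ0, Real.rpow_one]
    calc 2 * (N * (ρ * ρ ^ (1 / N))) = ρ * (2 * N * ρ ^ (1 / N)) := by ring
      _ ≤ ρ * ‖p₁ - p₂‖ := mul_le_mul_of_nonneg_left (hρ2.le.trans hsep) hρ0.le
  linarith

end ConvexHullGraph

namespace ConvexHullGraph

variable {d : ℕ}

/-! ### First order expansion of polynomials -/

theorem exists_affine_approx (P : MvPolynomial (Fin d) ℝ) :
    ∃ (a : ℝ) (q : Space d) (C : ℝ), 0 ≤ C ∧ ∀ v : Space d, ‖v‖ ≤ 1 →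
      |MvPolynomial.eval (fun j => v j) P - (a + inner ℝ q v)| ≤ C * ‖v‖ ^ 2 := by
  induction P using MvPolynomial.induction_on with
  | C a => exact ⟨a, 0, 0, le_rfl, fun v _ => by simp⟩
  | add P Q hP hQ =>
    obtain ⟨a, q, C, hC, h⟩ := hP
    obtain ⟨a', q', C', hC', h'⟩ := hQ
    refine ⟨a + a', q + q', C + C', add_nonneg hC hC', fun v hv => ?_⟩
    rw [map_add, inner_add_left]
    have h1 := abs_le.1 (h v hv)
    have h2 := abs_le.1 (h' v hv)
    rw [abs_le]
    constructor <;> linarith [h1.1, h1.2, h2.1, h2.2]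
  | mul_X P i hP =>
    obtain ⟨a, q, C, hC, h⟩ := hP
    refine ⟨0, a • EuclideanSpace.single i (1 : ℝ), C + ‖q‖, by positivity, fun v hv => ?_⟩
    rw [map_mul, MvPolynomial.eval_X, real_inner_smul_left, EuclideanSpace.inner_single_left]
    simp only [map_one, one_mul, zero_add]
    rw [← sub_mul, abs_mul]
    have h1 : |MvPolynomial.eval (fun j => v j) P - a| ≤ (C + ‖q‖) * ‖v‖ := by
      have h2 := abs_le.1 (h v hv)
      have h3 := abs_le.1 (abs_real_inner_le_norm q v)
      have h4 : C * ‖v‖ ^ 2 ≤ C * ‖v‖ := by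
        refine mul_le_mul_of_nonneg_left ?_ hC
        nlinarith [norm_nonneg v]
      rw [abs_le]
      constructor <;> linarith [h2.1, h2.2, h3.1, h3.2]
    calc _ ≤ (C + ‖q‖) * ‖v‖ * ‖v‖ :=
          mul_le_mul h1 (abs_apply_le_norm v i) (abs_nonneg _) (by positivity)
      _ = _ := by ring

theorem exists_affine_polynomial (a : ℝ) (q : Space d) :
    ∃ P : MvPolynomial (Fin d) ℝ, P.totalDegree ≤ 1 ∧
      ∀ v : Space d, MvPolynomial.eval (fun j => v j) P = a + inner ℝ q v := by
  refine ⟨MvPolynomial.C a + ∑ j, MvPolynomial.C (q j) * MvPolynomial.X j, ?_, fun v => ?_⟩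
  · refine (MvPolynomial.totalDegree_add _ _).trans (max_le (by simp) ?_)
    refine MvPolynomial.totalDegree_finsetSum_le fun j _ => ?_
    refine (MvPolynomial.totalDegree_mul _ _).trans ?_
    simp
  · simp [PiLp.inner_apply, mul_comm]

theorem exists_nat_large {r : ℝ} (hr : 0 < r) (K : ℝ) :
    ∃ n : ℕ, 1 / ((n : ℝ) + 1) < r ∧ K < n + 1 := by
  obtain ⟨n, hn⟩ := exists_nat_gt (max K (1 / r))
  have h1 := (le_max_left _ _).trans_lt hn
  have h2 := (le_max_right _ _).trans_lt hn
  refine ⟨n, ?_, by linarith⟩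
  rw [div_lt_iff₀ hr] at h2
  rw [div_lt_iff₀ (by positivity)]
  linarith

/-- The degree of the polynomial is immaterial here: its terms of order two and higher go into the
quadratic error, which is harmless for testing exponents near 0 and near 1. -/
theorem memHolderAt_expansion {φ : Space d → ℝ} {h : ℝ≥0} {x : Space d} (H : MemHolderAt φ h x) :
    ∃ (a : ℝ) (q : Space d) (C r : ℝ), 0 ≤ C ∧ 0 < r ∧ ∀ y ∈ cube d, dist y x < r →
      |φ y - (a + inner ℝ q (y - x))| ≤ C * ‖y - x‖ ^ (h : ℝ) + C * ‖y - x‖ ^ (2 : ℝ) := by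
  obtain ⟨P, -, C, hC⟩ := H
  obtain ⟨r, hr, hball⟩ := Metric.nhdsWithin_basis_ball.eventually_iff.1 hC
  obtain ⟨a, q, C', hC', hP⟩ := exists_affine_approx P
  refine ⟨a, q, |C| + C', min r 1, by positivity, by positivity, fun y hy hyx => ?_⟩
  have h1 := hball ⟨Metric.mem_ball.2 (hyx.trans_le (min_le_left _ _)), hy⟩
  have h2 := hP (y - x) (by rw [← dist_eq_norm]; exact (hyx.trans_le (min_le_right _ _)).le)
  simp only [PiLp.sub_apply] at h2
  have h3 : C * ‖y - x‖ ^ (h : ℝ) ≤ (|C| + C') * ‖y - x‖ ^ (h : ℝ) := by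
    refine mul_le_mul_of_nonneg_right ?_ (by positivity)
    linarith [le_abs_self C]
  have h4 : C' * ‖y - x‖ ^ 2 ≤ (|C| + C') * ‖y - x‖ ^ (2 : ℝ) := by
    rw [Real.rpow_two]
    refine mul_le_mul_of_nonneg_right ?_ (by positivity)
    linarith [abs_nonneg C]
  rw [abs_le] at *
  constructor <;> linarith [h1.1, h1.2, h2.1, h2.2]

/-! ### Behaviour at the boundary -/

variable {f : C(cube d, ℝ)}

/-- Concavity makes difference quotients from `x` at scales below `δ` at least the one at `δ`, so a
single steep scale suffices. -/
theorem eventually_le_envelope_inward {a : ℝ} (ha : a = 0 ∨ a = 1) {j : Fin d}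
    (H : ∀ n, SteepAlong a j n f) {x : Space d} (hx : x ∈ face a j) (K : ℝ) :
    ∀ᶠ t in 𝓝[>] (0 : ℝ), K * t ≤ envelope 1 f (inward a j t x) - envelope 1 f x := by
  obtain ⟨n, -, hn⟩ := exists_nat_large one_pos K
  obtain ⟨δ, hδ0, hδ1, hδ⟩ := H n
  have hN : (0 : ℝ) < n + 1 := by positivity
  have hN1 : (1 : ℝ) / (n + 1) ≤ 1 := by
    rw [div_le_one hN]; linarith [n.cast_nonneg (α := ℝ)]
  have h1 : (n + 1) * δ < envelope 1 f (inward a j δ x) - envelope 1 f x := by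
    refine lt_of_le_of_lt (mul_le_mul_of_nonneg_left ?_ hN.le) (hδ x hx)
    simpa using Real.rpow_le_rpow_of_exponent_ge hδ0 (hδ1.le.trans hN1) hN1
  filter_upwards [eventually_lt_nhdsGT_zero hδ0, eventually_mem_nhdsWithin] with t htδ ht0
  have ht0 : 0 < t := ht0
  have hs : inward a j t x = (1 - t / δ) • x + (t / δ) • inward a j δ x := by
    simp only [inward, smul_add, smul_smul]
    have h2 : t / δ * (δ * (1 - 2 * a)) = t * (1 - 2 * a) := by field_simp
    rw [← add_assoc, ← add_smul, h2, sub_add_cancel, one_smul]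
  have hts : t / δ ≤ 1 := (div_le_one hδ0).2 htδ.le
  have h2 := (concaveOn_envelope f).2 hx.1
    (inward_mem_cube ha ⟨hδ0.le, hδ1.le.trans hN1⟩ hx) (sub_nonneg.2 hts)
    (by positivity : 0 ≤ t / δ) (by ring)
  rw [← hs] at h2
  simp only [smul_eq_mul] at h2
  have h3 : t / δ * ((n + 1) * δ) ≤ t / δ * (envelope 1 f (inward a j δ x) - envelope 1 f x) :=
    mul_le_mul_of_nonneg_left h1.le (by positivity)
  have h4 : t / δ * (((n : ℝ) + 1) * δ) = (n + 1) * t := by field_simp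
  have h5 : K * t ≤ (n + 1) * t := mul_le_mul_of_nonneg_right hn.le ht0.le
  linarith

theorem hasRightPartial_envelope {j : Fin d} (H : ∀ n, SteepAlong 0 j n f) {x : Space d}
    (hx : x ∈ face 0 j) : HasRightPartial (envelope 1 f) j x ⊤ := by
  rw [HasRightPartial, EReal.tendsto_coe_nhds_top_iff, tendsto_atTop]
  intro K
  filter_upwards [eventually_le_envelope_inward (Or.inl rfl) H hx K, eventually_mem_nhdsWithin]
    with t ht ht0
  rw [le_div_iff₀ ht0]
  simpa [inward] using ht

theorem hasLeftPartial_envelope {j : Fin d} (H : ∀ n, SteepAlong 1 j n f) {x : Space d}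
    (hx : x ∈ face 1 j) : HasLeftPartial (envelope 1 f) j x ⊥ := by
  rw [HasLeftPartial, EReal.tendsto_coe_nhds_bot_iff, tendsto_atBot]
  intro K
  have hneg : Tendsto (fun t : ℝ => -t) (𝓝[<] 0) (𝓝[>] 0) := by
    simpa using tendsto_neg_nhdsLT (a := (0 : ℝ))
  filter_upwards [hneg.eventually (eventually_le_envelope_inward (Or.inr rfl) H hx (-K)),
    eventually_mem_nhdsWithin] with t ht ht0
  rw [div_le_iff_of_neg ht0]
  have h1 : inward 1 j (-t) x = x + t • EuclideanSpace.single j (1 : ℝ) := by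
    simp only [inward, smul_smul]
    norm_num
  rw [h1] at ht
  linarith

/-- At a face the envelope rises inward faster than any affine function, so an affine majorant
cannot touch there. -/
theorem mem_openCube_of_majorant (H₀ : ∀ j n, SteepAlong 0 j n f) (H₁ : ∀ j n, SteepAlong 1 j n f)
    {p : Space d} {c : ℝ} (hmaj : ∀ y : cube d, f y ≤ inner ℝ p y + c) {z : cube d}
    (hz : f z = inner ℝ p (z : Space d) + c) : (z : Space d) ∈ openCube d := by
  by_contra hzo
  obtain ⟨j, a, ha, hza⟩ := exists_mem_face_of_notMem_openCube z.2 hzo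
  have H : ∀ n, SteepAlong a j n f := by rcases ha with rfl | rfl <;> [exact H₀ j; exact H₁ j]
  obtain ⟨t, ⟨ht1, ht2⟩, ht0⟩ := (((eventually_le_envelope_inward ha H hza (‖p‖ + 1)).and
    (eventually_lt_nhdsGT_zero one_pos)).and eventually_mem_nhdsWithin).exists
  have ht0 : 0 < t := ht0
  have h1 := envelope_le_of_majorant hmaj (inward_mem_cube ha ⟨ht0.le, ht2.le⟩ hza)
  have h2 := le_envelope f z
  have h3 := real_inner_le_norm p (inward a j t z - z)
  rw [norm_inward_sub ha j ht0.le, inner_sub_right] at h3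
  linarith

theorem holderExponent_eq_zero {a : ℝ} (ha : a = 0 ∨ a = 1) {j : Fin d}
    (H : ∀ n, SteepAlong a j n f) {x : Space d} (hx : x ∈ face a j) :
    holderExponent (envelope 1 f) x = 0 := by
  refine le_antisymm (sSup_le ?_) zero_le
  rintro e ⟨h, hh, rfl⟩
  by_contra hpos
  have hpos : (0 : ℝ) < h := by
    simp only [nonpos_iff_eq_zero, ENNReal.coe_eq_zero] at hpos
    exact_mod_cast pos_iff_ne_zero.2 hpos
  obtain ⟨b, q, C, r, hC, hr, hexp⟩ := memHolderAt_expansion hh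
  -- With `1 / (n + 1) < h`, the linear part and both error terms are at most `(2 * C + ‖q‖) * δ ^
  -- (1 / (n + 1))`, less than the rise at scale `δ`.
  obtain ⟨n, hn1, hn2⟩ := exists_nat_large (lt_min hr hpos) (2 * C + ‖q‖)
  obtain ⟨δ, hδ0, hδ1, hδ⟩ := H n
  have hN : (0 : ℝ) < n + 1 := by positivity
  have hN1 : (1 : ℝ) / (n + 1) ≤ 1 := by
    rw [div_le_one hN]; linarith [n.cast_nonneg (α := ℝ)]
  have hδle : δ ≤ 1 := hδ1.le.trans hN1
  have hb : envelope 1 f x = b := by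
    have := hexp x hx.1 (by simpa using hr)
    simp only [sub_self, inner_zero_right, add_zero, norm_zero] at this
    rw [Real.zero_rpow hpos.ne', Real.zero_rpow two_ne_zero, mul_zero, add_zero] at this
    linarith [abs_nonpos_iff.1 this]
  have h1 := hexp _ (inward_mem_cube ha ⟨hδ0.le, hδle⟩ hx) (by
    rw [dist_eq_norm, norm_inward_sub ha j hδ0.le]
    exact hδ1.trans (hn1.trans_le (min_le_left _ _)))
  have h2 := hδ x hx
  have h3 := real_inner_le_norm q (inward a j δ x - x)
  rw [norm_inward_sub ha j hδ0.le] at h1 h3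
  have hle : ∀ e : ℝ, 1 / ((n : ℝ) + 1) ≤ e → δ ^ e ≤ δ ^ (1 / ((n : ℝ) + 1)) := fun e he =>
    Real.rpow_le_rpow_of_exponent_ge hδ0 hδle he
  have e1 := mul_le_mul_of_nonneg_left (hle h (hn1.le.trans (min_le_right _ _))) hC
  have e2 := mul_le_mul_of_nonneg_left (hle 2 (by linarith)) hC
  have e3 := mul_le_mul_of_nonneg_left (hle 1 hN1) (norm_nonneg q)
  rw [Real.rpow_one] at e3
  have e4 : 0 < δ ^ (1 / ((n : ℝ) + 1)) := by positivity
  have e5 := mul_lt_mul_of_pos_right hn2 e4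
  rw [hb] at h2
  linarith [(abs_le.1 h1).2]

/-! ### Interior points -/

/-- Carathéodory in the set where a supporting majorant touches `f`. With `d + 1` vertices and
positive weights, `x` is interior to their simplex, where concavity and the majorant pin the
envelope to an affine function. -/
theorem affine_or_lowRep {x : Space d} (hx : x ∈ openCube d) :
    (∃ (p : Space d) (c : ℝ), ∀ᶠ y in 𝓝 x, envelope 1 f y = inner ℝ p y + c) ∨ LowRep f x := by
  obtain ⟨p, c, hmaj, hval⟩ := exists_majorant f hx
  have hxh : x ∈ convexHull ℝ {y : Space d | ∃ h : y ∈ cube d, f ⟨y, h⟩ = inner ℝ p y + c} := by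
    obtain ⟨ι, _, w, z, hw, h1, hsum, hv⟩ := exists_sum_eq_envelope f (openCube_subset_cube d hx)
    rw [← hsum]
    refine (convex_convexHull ℝ _).sum_mem (fun i _ => (hw i).le) h1 fun i _ =>
      subset_convexHull ℝ _ ⟨(z i).2, ?_⟩
    exact eq_of_majorant_of_sum_eq hmaj hw h1 (by rw [hv, hval, hsum]) i
  obtain ⟨ι, _, z, w, hz, hai, hw, h1, hsum⟩ := eq_pos_convex_span_of_mem_convexHull hxh
  have hz' : ∀ i, ∃ h : z i ∈ cube d, f ⟨z i, h⟩ = inner ℝ p (z i) + c := fun i =>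
    hz (mem_range_self i)
  choose hzc hzf using hz'
  by_cases hcard : Fintype.card ι ≤ d
  · right
    obtain ⟨z', w', hw', h1', hz', hF⟩ := exists_fin_weights (V := Space d) hcard
      (fun i => (⟨z i, hzc i⟩ : cube d)) w (fun i => (hw i).le) h1
    refine ⟨p, c, z', w', hmaj, hw', h1', (hF Subtype.val).trans hsum, fun k => ?_⟩
    obtain ⟨i, hi⟩ := hz' k
    rw [← hi]
    exact hzf i
  · left
    have hcard' : Fintype.card ι = Module.finrank ℝ (Space d) + 1 := by
      refine le_antisymm (hai.card_le_finrank_succ.trans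
        (Nat.succ_le_succ (Submodule.finrank_le _))) ?_
      rw [finrank_euclideanSpace_fin]
      omega
    let B : AffineBasis ι ℝ (Space d) :=
      ⟨z, hai, hai.affineSpan_eq_top_iff_card_eq_finrank_add_one.2 hcard'⟩
    have hB : ⇑B = z := rfl
    have hint : x ∈ interior (convexHull ℝ (range z)) := by
      rw [← hB, B.interior_convexHull]
      intro i
      have := B.coord_apply_combination_of_mem (Finset.mem_univ i) h1
      rw [Finset.affineCombination_eq_linear_combination _ _ _ h1, hB, hsum] at this
      rw [this]
      exact hw i
    have hconv : convexHull ℝ (range z) ⊆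
        {y | y ∈ cube d ∧ inner ℝ p y + c ≤ envelope 1 f y} := by
      refine convexHull_min ?_ ?_
      · rintro _ ⟨i, rfl⟩
        exact ⟨hzc i, (hzf i).ge.trans (le_envelope f ⟨z i, hzc i⟩)⟩
      · rintro y ⟨hy, hy'⟩ y' ⟨hy₂, hy₂'⟩ s t hs ht hst
        refine ⟨convex_cube d hy hy₂ hs ht hst, ?_⟩
        refine le_trans ?_ ((concaveOn_envelope f).2 hy hy₂ hs ht hst)
        have e1 := mul_le_mul_of_nonneg_left hy' hs
        have e2 := mul_le_mul_of_nonneg_left hy₂' ht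
        have e3 : c = s * c + t * c := by rw [← add_mul, hst, one_mul]
        rw [inner_add_right, real_inner_smul_right, real_inner_smul_right, smul_eq_mul,
          smul_eq_mul]
        linarith
    refine ⟨p, c, ?_⟩
    filter_upwards [mem_interior_iff_mem_nhds.1 hint] with y hy
    have := hconv hy
    exact le_antisymm (envelope_le_of_majorant hmaj this.1) this.2

theorem holderExponent_eq_top_of_affine {φ : Space d → ℝ} {x p : Space d} {c : ℝ}
    (h : ∀ᶠ y in 𝓝 x, φ y = inner ℝ p y + c) : holderExponent φ x = ⊤ := by
  obtain ⟨P, hdeg, hP⟩ := exists_affine_polynomial (inner ℝ p x + c) p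
  -- Exponents `n + 1` are used so that degree one is always allowed; the error constant is 0.
  have hmem : ∀ n : ℕ, MemHolderAt φ ((n : ℝ≥0) + 1) x := fun n => by
    refine ⟨P, hdeg.trans (by rw [Nat.floor_add_one (by positivity)]; omega), 0, ?_⟩
    refine nhdsWithin_le_nhds ?_
    filter_upwards [h] with y hy
    have := hP (y - x)
    simp only [PiLp.sub_apply] at this
    rw [this, hy, inner_sub_right]
    ring_nf
    simp
  rw [eq_top_iff]
  refine ENNReal.le_of_forall_nnreal_lt fun r _ => ?_
  obtain ⟨n, hn⟩ := exists_nat_ge r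
  refine le_trans ?_ (le_sSup ⟨_, hmem n, rfl⟩)
  exact_mod_cast hn.trans (le_add_of_nonneg_right zero_le_one)

theorem one_le_holderExponent {φ : Space d → ℝ} {x : Space d} (h : DifferentiableAt ℝ φ x) :
    1 ≤ holderExponent φ x := by
  refine le_sSup ⟨1, ?_, by simp⟩
  obtain ⟨C, hC⟩ := h.isBigO_sub.bound
  refine ⟨MvPolynomial.C (φ x), by simp, C, nhdsWithin_le_nhds ?_⟩
  filter_upwards [hC] with y hy
  simpa using hy

/-- Second differences annihilate the affine part, so an exponent above 1 would make them too small
for a sharp ridge. -/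
theorem holderExponent_le_one {x : Space d} (hx : x ∈ openCube d) (hlow : LowRep f x)
    (H : ∀ n, SharpRidges n f) : holderExponent (envelope 1 f) x ≤ 1 := by
  refine sSup_le ?_
  rintro e ⟨h, hh, rfl⟩
  by_contra hpos
  have hpos : (1 : ℝ) < h := by
    rw [not_le, ENNReal.one_lt_coe_iff] at hpos
    exact_mod_cast hpos
  obtain ⟨b, q, C, r, hC, hr, hexp⟩ := memHolderAt_expansion hh
  obtain ⟨r', hr', hball⟩ := exists_closedBall_subset_cube hx
  obtain ⟨n, hn1, hn2⟩ := exists_nat_large (lt_min (lt_min hr hr') (sub_pos.2 hpos)) (32 * C)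
  obtain ⟨ρ, hρ0, hρ1, hρ⟩ := H n
  have hN : (0 : ℝ) < n + 1 := by positivity
  have hN0 : (0 : ℝ) < 1 / (n + 1) := by positivity
  have hN1 : (1 : ℝ) / (n + 1) ≤ 1 := by
    rw [div_le_one hN]; linarith [n.cast_nonneg (α := ℝ)]
  have hlt : (1 : ℝ) / (n + 1) < r := hn1.trans_le ((min_le_left _ _).trans (min_le_left _ _))
  have hlt' : (1 : ℝ) / (n + 1) < r' := hn1.trans_le ((min_le_left _ _).trans (min_le_right _ _))
  have hlth : 1 + (1 : ℝ) / (n + 1) ≤ h := by linarith [hn1.trans_le (min_le_right _ _)]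
  obtain ⟨z, u, hz, hu, hsec⟩ := hρ x ((Metric.closedBall_subset_closedBall hlt'.le).trans hball)
    hlow
  set s : ℝ := 1 / (n + 1)
  -- The ridge is centred at `z` within `ρ` of `x`, hence the radius `2 * ρ`. The total weight 4 of
  -- a second difference times `8 * C` gives the `32 * C` in the choice of `n`.
  have hest : ∀ y, ‖y - x‖ ≤ 2 * ρ →
      |envelope 1 f y - (b + inner ℝ q (y - x))| ≤ 8 * C * ρ ^ (1 + s) := fun y hy => by
    have h1 := hexp y (hball (by rw [Metric.mem_closedBall, dist_eq_norm]; linarith))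
      (by rw [dist_eq_norm]; linarith)
    have hle : ∀ e : ℝ, 1 + s ≤ e → ‖y - x‖ ^ e ≤ 4 * ρ ^ (1 + s) := fun e he => by
      calc ‖y - x‖ ^ e ≤ ‖y - x‖ ^ (1 + s) :=
            Real.rpow_le_rpow_of_exponent_ge' (norm_nonneg _) (by linarith) (by linarith) he
        _ ≤ (2 * ρ) ^ (1 + s) := Real.rpow_le_rpow (norm_nonneg _) hy (by linarith)
        _ = 2 ^ (1 + s) * ρ ^ (1 + s) := Real.mul_rpow (by norm_num) hρ0.le
        _ ≤ 4 * ρ ^ (1 + s) := by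
            refine mul_le_mul_of_nonneg_right ?_ (by positivity)
            calc (2 : ℝ) ^ (1 + s) ≤ 2 ^ (2 : ℝ) :=
                  Real.rpow_le_rpow_of_exponent_le (by norm_num) (by linarith)
              _ = 4 := by norm_num
    have e1 := mul_le_mul_of_nonneg_left (hle h hlth) hC
    have e2 := mul_le_mul_of_nonneg_left (hle 2 (by linarith)) hC
    linarith
  have hρu : ‖ρ • u‖ = ρ := by rw [norm_smul, hu, mul_one, Real.norm_of_nonneg hρ0.le]
  have h1 := hest (z + ρ • u) (by
    rw [add_sub_right_comm]
    refine (norm_add_le _ _).trans ?_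
    linarith)
  have h2 := hest (z - ρ • u) (by
    rw [sub_right_comm]
    refine (norm_sub_le _ _).trans ?_
    linarith)
  have h3 := hest z (by linarith)
  rw [inner_sub_right, inner_add_right] at h1
  rw [inner_sub_right, inner_sub_right] at h2
  rw [inner_sub_right] at h3
  have e5 := mul_lt_mul_of_pos_right hn2 (by positivity : 0 < ρ ^ (1 + s))
  linarith [(abs_le.1 h1).1, (abs_le.1 h2).1, (abs_le.1 h3).2]

/-! ### Smoothness in the interior -/

/-- Both majorants touch `f` at each point representing `x`, and such a point is interior. There `f`
would lie below a wedge whose second differences are linear in the scale, against `WedgeFree`. -/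
theorem supergradient_unique (H₀ : ∀ j n, SteepAlong 0 j n f) (H₁ : ∀ j n, SteepAlong 1 j n f)
    (Hw : ∀ n, WedgeFree n f) {x : Space d} (hx : x ∈ openCube d) {p p' : Space d} {c c' : ℝ}
    (h : ∀ y : cube d, f y ≤ inner ℝ p y + c) (hv : envelope 1 f x = inner ℝ p x + c)
    (h' : ∀ y : cube d, f y ≤ inner ℝ p' y + c') (hv' : envelope 1 f x = inner ℝ p' x + c') :
    p = p' := by
  by_contra hne
  have hpos : 0 < ‖p - p'‖ := norm_pos_iff.2 (sub_ne_zero.2 hne)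
  obtain ⟨ι, _, w, z, hw, h1, hsum, hval⟩ := exists_sum_eq_envelope f (openCube_subset_cube d hx)
  have hι : Nonempty ι := by
    by_contra hι
    rw [not_nonempty_iff] at hι
    simp at h1
  obtain ⟨i⟩ := hι
  have hz := eq_of_majorant_of_sum_eq h hw h1 (by rw [hval, hv, hsum]) i
  have hz' := eq_of_majorant_of_sum_eq h' hw h1 (by rw [hval, hv', hsum]) i
  have hzo := mem_openCube_of_majorant H₀ H₁ h hz
  obtain ⟨r, hr, hball⟩ := exists_closedBall_subset_cube hzo
  obtain ⟨n, hn, -⟩ := exists_nat_large (lt_min hr hpos) 0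
  obtain ⟨ρ, hρ0, hρ1, hρ⟩ := Hw n
  set u : Space d := ‖p - p'‖⁻¹ • (p - p') with hu_def
  have hu : ‖u‖ = 1 := by
    rw [norm_smul, norm_inv, norm_norm, inv_mul_cancel₀ hpos.ne']
  have hρu : ‖ρ • u‖ = ρ := by rw [norm_smul, hu, mul_one, Real.norm_of_nonneg hρ0.le]
  have hρr : ρ ≤ r := (hρ1.trans (hn.trans_le (min_le_left _ _))).le
  have hplus : (z i : Space d) + ρ • u ∈ cube d := hball (by simpa [hρu] using hρr)
  have hminus : (z i : Space d) - ρ • u ∈ cube d := hball (by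
    rw [Metric.mem_closedBall, dist_eq_norm, sub_sub_cancel_left, norm_neg, hρu]; exact hρr)
  have hle := le_envelope f (z i)
  have hup := second_difference_le hne h h' (hz.symm.le.trans hle) (hz'.symm.le.trans hle)
    hplus hminus
  rw [← hu_def] at hup
  have hcontact : envelope 1 f (z i) = f (z i) := (mem_contactSet_of_majorant h hz).2
  have hlow := hρ ⟨_, hplus⟩ ⟨_, hminus⟩ (z i) (by simp only; rw [two_smul]; abel) (by
    have : (z i : Space d) + ρ • u - (z i - ρ • u) = (2 : ℝ) • (ρ • u) := by
      rw [two_smul]; abel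
    simp only
    rw [this, norm_smul, hρu]; simp)
  have e1 := le_envelope f ⟨_, hplus⟩
  have e2 := le_envelope f ⟨_, hminus⟩
  have e3 : ρ * (1 / ((n : ℝ) + 1)) < ρ * ‖p - p'‖ :=
    mul_lt_mul_of_pos_left (hn.trans_le (min_le_right _ _)) hρ0
  rw [mul_one_div] at e3
  linarith

/-- The supergradient inequalities based at `x` and at `y` enclose the linearisation error between
`inner ℝ (p y - p x) (y - x)` and 0. -/
theorem hasFDerivAt_of_supergradient {s : Set (Space d)} (hs : IsOpen s) {φ : Space d → ℝ}
    {p : Space d → Space d} (hsup : ∀ x ∈ s, ∀ y ∈ s, φ y ≤ φ x + inner ℝ (p x) (y - x))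
    {x : Space d} (hx : x ∈ s) (hp : Tendsto p (𝓝 x) (𝓝 (p x))) :
    HasFDerivAt φ (innerSL ℝ (p x)) x := by
  refine HasFDerivAt.of_isLittleO (Asymptotics.isLittleO_iff.2 fun ε hε => ?_)
  filter_upwards [hs.mem_nhds hx, Metric.tendsto_nhds.1 hp ε hε] with y hy hyε
  have h1 := hsup x hx y hy
  have h2 := hsup y hy x hx
  have h3 := abs_le.1 (abs_real_inner_le_norm (p y - p x) (y - x))
  have h4 : ‖p y - p x‖ * ‖y - x‖ ≤ ε * ‖y - x‖ := by
    refine mul_le_mul_of_nonneg_right ?_ (norm_nonneg _)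
    rw [← dist_eq_norm]; exact hyε.le
  rw [inner_sub_left] at h3
  have h5 : inner ℝ (p y) (x - y) = -inner ℝ (p y) (y - x) := by
    rw [← inner_neg_right, neg_sub]
  have h6 : 0 ≤ ε * ‖y - x‖ := by positivity
  rw [innerSL_apply_apply, Real.norm_eq_abs, abs_le]
  constructor <;> linarith [h3.1, h3.2]

theorem contDiffOn_one_of_supergradient {s : Set (Space d)} (hs : IsOpen s) {φ : Space d → ℝ}
    {p : Space d → Space d} (hsup : ∀ x ∈ s, ∀ y ∈ s, φ y ≤ φ x + inner ℝ (p x) (y - x))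
    (hp : ∀ x ∈ s, Tendsto p (𝓝 x) (𝓝 (p x))) : ContDiffOn ℝ 1 φ s := by
  have hderiv := fun x (hx : x ∈ s) => hasFDerivAt_of_supergradient hs hsup hx (hp x hx)
  rw [← zero_add (1 : WithTop ℕ∞), contDiffOn_succ_iff_fderiv_of_isOpen hs]
  refine ⟨fun x hx => (hderiv x hx).differentiableAt.differentiableWithinAt, by simp, ?_⟩
  rw [contDiffOn_zero]
  have : ContinuousOn (fun x => innerSL ℝ (p x)) s := fun x hx =>
    (((innerSL ℝ).continuous.tendsto _).comp (hp x hx)).mono_left nhdsWithin_le_nhds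
  exact this.congr fun x hx => (hderiv x hx).fderiv

theorem contDiffOn_envelope (H₀ : ∀ j n, SteepAlong 0 j n f) (H₁ : ∀ j n, SteepAlong 1 j n f)
    (Hw : ∀ n, WedgeFree n f) : ContDiffOn ℝ 1 (envelope 1 f) (openCube d) := by
  have hex : ∀ x : Space d, ∃ p : Space d, x ∈ openCube d →
      ∀ y : cube d, f y ≤ inner ℝ p (y : Space d) + (envelope 1 f x - inner ℝ p x) := fun x => by
    by_cases hx : x ∈ openCube d
    · obtain ⟨p, c, hmaj, hval⟩ := exists_majorant f hx
      refine ⟨p, fun _ y => ?_⟩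
      rw [hval, add_sub_cancel_left]
      exact hmaj y
    · exact ⟨0, fun h => absurd h hx⟩
  choose p hp using hex
  have hsup : ∀ x ∈ openCube d, ∀ y ∈ cube d,
      envelope 1 f y ≤ envelope 1 f x + inner ℝ (p x) (y - x) := fun x hx y hy => by
    have := envelope_le_of_majorant (hp x hx) hy
    rw [inner_sub_right]
    linarith
  have hopen := isOpen_openCube d
  have hcont : ContinuousOn (envelope 1 f) (openCube d) :=
    ((concaveOn_envelope f).subset (openCube_subset_cube d) (convex_openCube d)).continuousOn hopen
  have hpc : ∀ x ∈ openCube d, Tendsto p (𝓝 x) (𝓝 (p x)) := by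
    intro x hx
    obtain ⟨r, hr, hball⟩ := exists_closedBall_subset_cube hx
    have hbd : ∀ᶠ y in 𝓝 x, p y ∈ Metric.closedBall (0 : Space d) (2 * ‖f‖ / (r / 2)) := by
      filter_upwards [hopen.mem_nhds hx, Metric.ball_mem_nhds x (half_pos hr)] with y hy hyr
      rw [mem_closedBall_zero_iff]
      refine norm_le_of_majorant (half_pos hr) (fun z => f.norm_coe_le_norm z) (x := y) ?_
        (hp y hy) ?_
      · refine (Metric.closedBall_subset_closedBall' ?_).trans hball
        linarith [Metric.mem_ball.1 hyr]
      · rw [add_sub_cancel]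
        exact (abs_le.1 (abs_envelope_le (fun z => f.norm_coe_le_norm z)
          (openCube_subset_cube d hy))).2
    -- Supergradients are locally bounded, and each cluster point is a supergradient at `x` by
    -- passing to the limit; uniqueness then gives convergence.
    refine (isCompact_closedBall _ _).tendsto_nhds_of_unique_mapClusterPt hbd fun q _ hq => ?_
    obtain ⟨U, hU, hUq⟩ := mapClusterPt_iff_ultrafilter.1 hq
    refine supergradient_unique H₀ H₁ Hw hx (c := envelope 1 f x - inner ℝ q x)
      (c' := envelope 1 f x - inner ℝ (p x) x) (fun y => ?_) (by ring) (hp x hx) (by ring)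
    have hxU : Tendsto (fun y : Space d => y) U (𝓝 x) := hU
    have h1 : Tendsto (fun w => inner ℝ (p w) (y : Space d) + (envelope 1 f w - inner ℝ (p w) w)) U
        (𝓝 (inner ℝ q (y : Space d) + (envelope 1 f x - inner ℝ q x))) :=
      (hUq.inner tendsto_const_nhds).add
        ((((hcont.continuousAt (hopen.mem_nhds hx)).tendsto).comp hxU).sub (hUq.inner hxU))
    refine ge_of_tendsto h1 ?_
    filter_upwards [hU (hopen.mem_nhds hx)] with w hw
    exact hp w hw y
  exact contDiffOn_one_of_supergradient hopen
    (fun x hx y hy => hsup x hx y (openCube_subset_cube d hy)) hpc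

end ConvexHullGraph

namespace ConvexHullGraph

/-! ### Hausdorff dimension estimates -/

/-- Covers at scales tending to 0 with bounded sums of `t`-th powers of diameters make the
`t`-dimensional measure finite. -/
theorem dimH_le_of_covers {d : ℕ} {S : Set (Space d)} {t : ℝ≥0} {A K : ℝ}
    (h : ∀ n : ℕ, ∃ (ι : Type) (_ : Fintype ι) (c : ι → Space d) (r : ℝ), 0 ≤ r ∧
      r ≤ A * (1 / ((n : ℝ) + 1)) ∧ (∀ x ∈ S, ∃ i, dist x (c i) ≤ r) ∧
      Fintype.card ι * r ^ (t : ℝ) ≤ K) : dimH S ≤ t := by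
  choose ι hι c r hr0 hr hcov hK using h
  have hediam : ∀ n i, Metric.ediam (Metric.closedBall (c n i) (r n)) ≤ ENNReal.ofReal (2 * r n) :=
    fun n i => by
      rw [← Metric.closedEBall_ofReal (hr0 n)]
      refine Metric.ediam_closedEBall_le.trans ?_
      rw [ENNReal.ofReal_mul two_pos.le]
      simp
  refine dimH_le_of_hausdorffMeasure_ne_top (ne_top_of_le_ne_top
    (b := ENNReal.ofReal (2 ^ (t : ℝ) * K)) ENNReal.ofReal_ne_top ?_)
  refine (MeasureTheory.Measure.hausdorffMeasure_le_liminf_sum (l := atTop) (t : ℝ) S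
    (fun n => ENNReal.ofReal (2 * r n)) ?_ (fun n i => Metric.closedBall (c n i) (r n))
    (Eventually.of_forall fun n => hediam n) (Eventually.of_forall fun n x hx => ?_)).trans ?_
  · have h1 : Tendsto (fun n : ℕ => 2 * (A * (1 / ((n : ℝ) + 1)))) atTop (𝓝 (2 * (A * 0))) :=
      (tendsto_one_div_add_atTop_nhds_zero_nat.const_mul A).const_mul 2
    rw [mul_zero, mul_zero] at h1
    have h2 : Tendsto (fun n => 2 * r n) atTop (𝓝 0) := by
      refine squeeze_zero (fun n => by linarith [hr0 n]) (fun n => ?_) h1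
      linarith [hr n]
    simpa using ENNReal.tendsto_ofReal h2
  · obtain ⟨i, hi⟩ := hcov n x hx
    exact mem_iUnion.2 ⟨i, hi⟩
  · refine le_trans (liminf_le_liminf (v := fun _ => ENNReal.ofReal (2 ^ (t : ℝ) * K))
      (Eventually.of_forall fun n => ?_)) (by simp)
    calc ∑ i, Metric.ediam (Metric.closedBall (c n i) (r n)) ^ (t : ℝ)
        ≤ ∑ _i : ι n, ENNReal.ofReal (2 * r n) ^ (t : ℝ) :=
          Finset.sum_le_sum fun i _ => ENNReal.rpow_le_rpow (hediam n i) t.2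
      _ = ENNReal.ofReal (Fintype.card (ι n) * (2 * r n) ^ (t : ℝ)) := by
          rw [Finset.sum_const, nsmul_eq_mul,
            ENNReal.ofReal_rpow_of_nonneg (by linarith [hr0 n]) t.coe_nonneg,
            ENNReal.ofReal_mul (Nat.cast_nonneg _)]
          simp
      _ ≤ _ := by
          refine ENNReal.ofReal_le_ofReal ?_
          rw [Real.mul_rpow two_pos.le (hr0 n)]
          have : 0 ≤ (2 : ℝ) ^ (t : ℝ) := by positivity
          nlinarith [mul_le_mul_of_nonneg_left (hK n) this]

theorem dimH_contactSet {d : ℕ} {f : C(cube d, ℝ)} (H : ∀ n, ThinContact n f) :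
    dimH (contactSet 1 f) = 0 := by
  refine le_antisymm (le_of_forall_pos_le_add ?_) zero_le
  intro ε hε
  rw [zero_add]
  rcases eq_or_ne ε ⊤ with rfl | hε'
  · exact le_top
  lift ε to ℝ≥0 using hε'
  have hε0 : (0 : ℝ) < ε := by exact_mod_cast hε
  obtain ⟨n₀, hn₀, -⟩ := exists_nat_large hε0 0
  refine dimH_le_of_covers (A := 1) (K := 1) fun n => ?_
  obtain ⟨ι, _, P, r, hr0, hr1, hcov, hcard⟩ := H (max n n₀)
  set N : ℕ := max n n₀
  have hN : ∀ k : ℕ, k ≤ N → 1 / ((N : ℝ) + 1) ≤ 1 / (k + 1) := fun k hk =>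
    one_div_le_one_div_of_le (by positivity) (by gcongr)
  have hN1 : 1 / ((N : ℝ) + 1) ≤ 1 := by simpa using hN 0 (Nat.zero_le _)
  refine ⟨ι, inferInstance, fun i => P i, r, hr0.le, ?_, fun x hx => ?_, ?_⟩
  · rw [one_mul]; exact hr1.le.trans (hN n (le_max_left _ _))
  · obtain ⟨i, hi⟩ := hcov x hx
    exact ⟨i, hi.le⟩
  · refine le_trans (mul_le_mul_of_nonneg_left ?_ (Nat.cast_nonneg _)) (hcard.trans hN1)
    exact Real.rpow_le_rpow_of_exponent_ge hr0 (hr1.le.trans hN1)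
      ((hN n₀ (le_max_right _ _)).trans hn₀.le)

/-! ### Dimension of the set of points with a low representation -/

theorem sum_smul_eq_last {m : ℕ} {V : Type*} [AddCommGroup V] [Module ℝ V] {w : Fin (m + 1) → ℝ}
    (h1 : ∑ k, w k = 1) (y : Fin (m + 1) → V) :
    ∑ k, w k • y k = y (Fin.last m) +
      ∑ k : Fin m, w k.castSucc • (y k.castSucc - y (Fin.last m)) := by
  rw [Fin.sum_univ_castSucc] at h1
  have h2 : w (Fin.last m) = 1 - ∑ k : Fin m, w k.castSucc := by linarith
  rw [Fin.sum_univ_castSucc, h2]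
  simp only [smul_sub, Finset.sum_sub_distrib, sub_smul, one_smul, Finset.sum_smul]
  abel

/-- The weights sum to 1, so only `m` of them are free; rounding these down to multiples of `r`
leaves about `r ^ (-m)` centres per simplex. -/
theorem exists_simplex_net {m : ℕ} {ι : Type} [Fintype ι] (P : ι → cube (m + 1)) {r : ℝ}
    (hr : 0 < r) :
    ∃ c : (Fin (m + 1) → ι) × (Fin m → Fin (⌊1 / r⌋₊ + 1)) → Space (m + 1),
      ∀ (T : Fin (m + 1) → ι) (w : Fin (m + 1) → ℝ), (∀ k, 0 ≤ w k) → ∑ k, w k = 1 →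
      ∃ a, ‖∑ k, w k • (P (T k) : Space (m + 1)) - c (T, a)‖ ≤ m * (r * (2 * (m + 1))) := by
  refine ⟨fun b => (P (b.1 (Fin.last m)) : Space (m + 1)) + ∑ k : Fin m, (((b.2 k : ℕ) : ℝ) * r) •
    ((P (b.1 k.castSucc) : Space (m + 1)) - P (b.1 (Fin.last m))), fun T w hw h1 => ?_⟩
  have hw1 : ∀ k, w k ≤ 1 := fun k => by
    rw [← h1]; exact Finset.single_le_sum (fun i _ => hw i) (Finset.mem_univ k)
  refine ⟨fun k => ⟨⌊w k.castSucc / r⌋₊, Nat.lt_succ_of_le (Nat.floor_le_floor (by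
    gcongr; exact hw1 _))⟩, ?_⟩
  simp only
  rw [sum_smul_eq_last h1, add_sub_add_left_eq_sub, ← Finset.sum_sub_distrib]
  calc _ ≤ ∑ _k : Fin m, r * (2 * (m + 1)) := by
        refine norm_sum_le_of_le _ fun k _ => ?_
        rw [← sub_smul, norm_smul]
        refine mul_le_mul ?_ ?_ (norm_nonneg _) hr.le
        · have e1 := Nat.floor_le (div_nonneg (hw k.castSucc) hr.le)
          have e2 := (Nat.lt_floor_add_one (w k.castSucc / r)).le
          rw [le_div_iff₀ hr] at e1
          rw [div_le_iff₀ hr] at e2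
          rw [Real.norm_eq_abs, abs_le]
          constructor <;> linarith
        · refine (norm_sub_le _ _).trans ?_
          have e1 := norm_le_of_mem_cube (P (T k.castSucc)).2
          have e2 := norm_le_of_mem_cube (P (T (Fin.last m))).2
          push_cast at e1 e2
          linarith
    _ = _ := by simp

theorem dimH_lowRep_le {m : ℕ} {f : C(cube (m + 1), ℝ)} (H : ∀ n, ThinContact n f) :
    dimH {x | LowRep f x} ≤ m := by
  refine ENNReal.le_of_forall_pos_le_add fun s hs _ => ?_
  have hs0 : (0 : ℝ) < s := by exact_mod_cast hs
  -- Choosing `m + 1` cover balls costs the power `m + 1` of their number, so the excess exponent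
  -- `s` is shared among `m + 1` factors.
  obtain ⟨n₀, hn₀, -⟩ := exists_nat_large (r := s / (m + 1)) (by positivity) 0
  set A : ℝ := 1 + m * (2 * (m + 1))
  have hA : 0 < A := by positivity
  have hcast : (m : ℝ≥0∞) + s = ((m + s : ℝ≥0) : ℝ≥0∞) := by push_cast; rfl
  rw [hcast]
  refine dimH_le_of_covers (A := A) (K := 2 ^ m * A ^ ((m : ℝ) + s)) fun n => ?_
  obtain ⟨ι, _, P, r, hr0, hr1, hcov, hcard⟩ := H (max n n₀)
  set N : ℕ := max n n₀
  have hN : ∀ k : ℕ, k ≤ N → 1 / ((N : ℝ) + 1) ≤ 1 / (k + 1) := fun k hk =>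
    one_div_le_one_div_of_le (by positivity) (by gcongr)
  have hN1 : 1 / ((N : ℝ) + 1) ≤ 1 := by simpa using hN 0 (Nat.zero_le _)
  have hrle : r ≤ 1 := hr1.le.trans hN1
  obtain ⟨c, hc⟩ := exists_simplex_net P hr0
  refine ⟨_, inferInstance, c, A * r, by positivity, ?_, ?_, ?_⟩
  · exact mul_le_mul_of_nonneg_left (hr1.le.trans (hN n (le_max_left _ _))) hA.le
  · rintro x ⟨p, b, z, w, hmaj, hw, h1, hsum, hz⟩
    choose T hT using fun k => hcov _ (mem_contactSet_of_majorant hmaj (hz k))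
    obtain ⟨a, ha⟩ := hc T w hw h1
    refine ⟨(T, a), ?_⟩
    have h2 : ‖x - ∑ k, w k • (P (T k) : Space (m + 1))‖ ≤ r := by
      rw [← hsum]
      exact norm_sum_smul_sub_le hw h1 fun k => by rw [← dist_eq_norm]; exact (hT k).le
    rw [dist_eq_norm]
    refine (norm_sub_le_norm_sub_add_norm_sub _ _ _).trans ((add_le_add h2 ha).trans (le_of_eq ?_))
    simp only [A]; ring
  · have hfl : ((⌊1 / r⌋₊ : ℝ) + 1) ≤ 2 / r := by
      have e1 := Nat.floor_le (by positivity : 0 ≤ 1 / r)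
      have e2 : 1 ≤ 1 / r := (one_le_div hr0).2 hrle
      have e3 : 2 / r = 1 / r + 1 / r := by ring
      linarith
    have e1 : ((⌊1 / r⌋₊ : ℝ) + 1) ^ m ≤ 2 ^ m * (r ^ m)⁻¹ := by
      calc _ ≤ (2 / r) ^ m := by gcongr
        _ = _ := by rw [div_pow, div_eq_mul_inv]
    have e2 : (A * r) ^ ((m : ℝ) + s) = A ^ ((m : ℝ) + s) * (r ^ m * r ^ (s : ℝ)) := by
      rw [Real.mul_rpow hA.le hr0.le, Real.rpow_add hr0, Real.rpow_natCast]
    have e3 : r ^ (s : ℝ) ≤ (r ^ (1 / ((N : ℝ) + 1))) ^ (m + 1) := by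
      rw [← Real.rpow_natCast, ← Real.rpow_mul hr0.le]
      refine Real.rpow_le_rpow_of_exponent_ge hr0 hrle ?_
      have := (hN n₀ (le_max_right _ _)).trans hn₀.le
      rw [le_div_iff₀ (by positivity)] at this
      push_cast
      exact this
    have e4 : (Fintype.card ι : ℝ) ^ (m + 1) * r ^ (s : ℝ) ≤ 1 := by
      calc _ ≤ (Fintype.card ι : ℝ) ^ (m + 1) * (r ^ (1 / ((N : ℝ) + 1))) ^ (m + 1) := by gcongr
        _ = (Fintype.card ι * r ^ (1 / ((N : ℝ) + 1))) ^ (m + 1) := by rw [mul_pow]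
        _ ≤ 1 := pow_le_one₀ (by positivity) (hcard.trans hN1)
    have e5 : r ^ m ≠ 0 := by positivity
    simp only [Fintype.card_prod, Fintype.card_fun, Fintype.card_fin, NNReal.coe_add,
      NNReal.coe_natCast]
    push_cast
    rw [e2]
    calc (Fintype.card ι : ℝ) ^ (m + 1) * (⌊1 / r⌋₊ + 1) ^ m *
          (A ^ ((m : ℝ) + s) * (r ^ m * r ^ (s : ℝ)))
        ≤ (Fintype.card ι : ℝ) ^ (m + 1) * (2 ^ m * (r ^ m)⁻¹) *
          (A ^ ((m : ℝ) + s) * (r ^ m * r ^ (s : ℝ))) := by gcongr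
      _ = 2 ^ m * A ^ ((m : ℝ) + s) * ((Fintype.card ι : ℝ) ^ (m + 1) * r ^ (s : ℝ)) := by
          field_simp
      _ ≤ 2 ^ m * A ^ ((m : ℝ) + s) * 1 := by gcongr
      _ = _ := mul_one _

/-! ### Dimension of faces and lower bounds by projection -/

theorem dimH_face_le {m : ℕ} (a : ℝ) (j : Fin (m + 1)) :
    dimH (face a j) ≤ m := by
  let F : Space m → Space (m + 1) := fun v =>
    WithLp.toLp 2 (j.insertNth (α := fun _ => ℝ) a fun k => v k)
  have hF : LipschitzWith 1 F := LipschitzWith.of_dist_le_mul fun u v => by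
    rw [NNReal.coe_one, one_mul, EuclideanSpace.dist_eq, EuclideanSpace.dist_eq,
      Fin.sum_univ_succAbove _ j]
    simp [F]
  have hsub : face a j ⊆ F '' univ := fun x hx => by
    refine ⟨WithLp.toLp 2 fun k => x (j.succAbove k), mem_univ _, ?_⟩
    ext k
    refine Fin.succAboveCases j ?_ (fun i => ?_) k
    · simp [F, hx.2]
    · simp [F]
  refine (dimH_mono hsub).trans ((hF.dimH_image_le _).trans (le_of_eq ?_))
  rw [Real.dimH_univ_eq_finrank, finrank_euclideanSpace_fin]

/-- The projection forgetting the first coordinate. -/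
noncomputable def dropFirst {m : ℕ} (x : Space (m + 1)) : Space m := WithLp.toLp 2 fun k => x k.succ

theorem interior_openCube_nonempty (m : ℕ) : (interior (openCube m)).Nonempty := by
  rw [(isOpen_openCube m).interior_eq]
  exact ⟨WithLp.toLp 2 fun _ => 1 / 2, fun j => by constructor <;> norm_num⟩

theorem dimH_openCube (m : ℕ) : dimH (openCube m) = m := by
  rw [Real.dimH_of_nonempty_interior (interior_openCube_nonempty m), finrank_euclideanSpace_fin]

theorem le_dimH_of_dropFirst {m : ℕ} {S : Set (Space (m + 1))}
    (h : openCube m ⊆ dropFirst '' S) : (m : ℝ≥0∞) ≤ dimH S := by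
  have hF : LipschitzWith 1 (dropFirst (m := m)) := LipschitzWith.of_dist_le_mul fun u v => by
    rw [NNReal.coe_one, one_mul, EuclideanSpace.dist_eq, EuclideanSpace.dist_eq,
      Fin.sum_univ_succ]
    refine Real.sqrt_le_sqrt ?_
    simp only [dropFirst]
    exact le_add_of_nonneg_left (by positivity)
  rw [← dimH_openCube m]
  exact (dimH_mono h).trans (hF.dimH_image_le S)

theorem exists_affine_of_locally_affine {ψ : ℝ → ℝ}
    (h : ∀ t ∈ Ioo (0 : ℝ) 1, ∃ α β : ℝ, ∀ᶠ s in 𝓝 t, ψ s = α + β * s) :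
    ∃ α β : ℝ, ∀ t ∈ Ioo (0 : ℝ) 1, ψ t = α + β * t := by
  have hder : ∀ t ∈ Ioo (0 : ℝ) 1, ∃ β, ∀ᶠ s in 𝓝 t, HasDerivAt ψ β s := fun t ht => by
    obtain ⟨α, β, hs⟩ := h t ht
    refine ⟨β, hs.eventually_nhds.mono fun s hs' => ?_⟩
    have h1 : HasDerivAt (fun s => α + β * s) β s := by
      simpa using ((hasDerivAt_id s).const_mul β).const_add α
    exact h1.congr_of_eventuallyEq hs'
  have hder2 : ∀ t ∈ Ioo (0 : ℝ) 1, HasDerivAt (deriv ψ) 0 t := fun t ht => by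
    obtain ⟨β, hβ⟩ := hder t ht
    exact (hasDerivAt_const t β).congr_of_eventuallyEq (hβ.mono fun s hs => hs.deriv)
  have hmid : (1 / 2 : ℝ) ∈ Ioo (0 : ℝ) 1 := by constructor <;> norm_num
  set β := deriv ψ (1 / 2)
  have hconst : ∀ t ∈ Ioo (0 : ℝ) 1, deriv ψ t = β := fun t ht =>
    isOpen_Ioo.is_const_of_deriv_eq_zero isPreconnected_Ioo
      (fun s hs => (hder2 s hs).differentiableAt.differentiableWithinAt)
      (fun s hs => (hder2 s hs).deriv) ht hmid
  have hψ : ∀ t ∈ Ioo (0 : ℝ) 1, HasDerivAt (fun s => ψ s - β * s) 0 t := fun t ht => by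
    obtain ⟨γ, hγ⟩ := hder t ht
    have h1 := hγ.self_of_nhds
    rw [← hconst t ht, h1.deriv]
    simpa using h1.fun_sub ((hasDerivAt_id t).const_mul γ)
  refine ⟨ψ (1 / 2) - β * (1 / 2), β, fun t ht => ?_⟩
  have := isOpen_Ioo.is_const_of_deriv_eq_zero isPreconnected_Ioo
    (fun s hs => (hψ s hs).differentiableAt.differentiableWithinAt)
    (fun s hs => (hψ s hs).deriv) ht hmid
  linarith

/-- Local affinity along the whole open segment would make the envelope equal to `α + β * t` there.
Closedness of the hull gives `α` at most the value at the face, so the slope at the face would be at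
most `β`, though it is infinite. -/
theorem exists_not_affine_on_line {d : ℕ} {f : C(cube d, ℝ)} {j : Fin d}
    (H : ∀ n, SteepAlong 0 j n f) {x : Space d} (hx : x ∈ face 0 j) :
    ∃ t ∈ Ioo (0 : ℝ) 1, ¬ ∃ (p : Space d) (c : ℝ),
      ∀ᶠ y in 𝓝 (inward 0 j t x), envelope 1 f y = inner ℝ p y + c := by
  by_contra! hall
  have hcont : Continuous fun t : ℝ => inward 0 j t x := by unfold inward; fun_prop
  obtain ⟨α, β, hαβ⟩ := exists_affine_of_locally_affine
    (ψ := fun t => envelope 1 f (inward 0 j t x)) fun t ht => by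
      obtain ⟨p, c, hpc⟩ := hall t ht
      refine ⟨inner ℝ p x + c, inner ℝ p ((1 - 2 * (0 : ℝ)) • EuclideanSpace.single j (1 : ℝ)), ?_⟩
      filter_upwards [hcont.continuousAt.eventually hpc] with s hs
      rw [hs, inward, inner_add_right, real_inner_smul_right]
      ring
  have hIoo : ∀ᶠ t in 𝓝[>] (0 : ℝ), t ∈ Ioo (0 : ℝ) 1 := Ioo_mem_nhdsGT one_pos
  have hmem : (x, α) ∈ graphHull f := by
    refine (isCompact_graphHull f).isClosed.mem_of_tendsto (b := 𝓝[>] (0 : ℝ))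
      (f := fun t : ℝ => (inward 0 j t x, α + β * t)) ?_ ?_
    · have : Continuous fun t : ℝ => (inward 0 j t x, α + β * t) :=
        hcont.prodMk (by fun_prop)
      have h0 := (this.tendsto 0).mono_left (nhdsWithin_le_nhds (s := Ioi 0))
      simpa [inward] using h0
    · filter_upwards [hIoo] with t ht
      rw [← hαβ t ht]
      exact envelope_mem_graphHull (inward_mem_cube (Or.inl rfl) ⟨ht.1.le, ht.2.le⟩ hx)
  have hα := le_envelope_of_mem hmem
  obtain ⟨t, ht, hK⟩ := (hIoo.and
    (eventually_le_envelope_inward (Or.inl rfl) H hx (β + 1))).exists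
  have := hαβ t ht
  linarith [ht.1]

end ConvexHullGraph

namespace ConvexHullGraph

/-! ### Typical functions -/

/-- The properties of typical functions from which the structure of the upper envelope is
derived. -/
structure Typical {d : ℕ} (f : C(cube d, ℝ)) : Prop where
  steep_zero : ∀ j n, SteepAlong 0 j n f
  steep_one : ∀ j n, SteepAlong 1 j n f
  wedgeFree : ∀ n, WedgeFree n f
  thinContact : ∀ n, ThinContact n f
  sharpRidges : ∀ n, SharpRidges n f

theorem typical_mem_residual {d : ℕ} (hd : 0 < d) :
    {f : C(cube d, ℝ) | Typical f} ∈ residual C(cube d, ℝ) := by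
  have h0 := eventually_countable_forall.2 fun j : Fin d => eventually_countable_forall.2
    fun n => steepAlong_mem_residual (Or.inl rfl : (0 : ℝ) = 0 ∨ (0 : ℝ) = 1) j n
  have h1 := eventually_countable_forall.2 fun j : Fin d => eventually_countable_forall.2
    fun n => steepAlong_mem_residual (Or.inr rfl : (1 : ℝ) = 0 ∨ (1 : ℝ) = 1) j n
  have h2 := eventually_countable_forall.2 fun n => wedgeFree_mem_residual (d := d) n
  have h3 := eventually_countable_forall.2 fun n => thinContact_and_sharpRidges_mem_residual hd n
  filter_upwards [h0, h1, h2, h3] with f e0 e1 e2 e3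
  exact ⟨e0, e1, e2, fun n => (e3 n).1, fun n => (e3 n).2⟩

theorem typical_neg_mem_residual {d : ℕ} (hd : 0 < d) :
    {f : C(cube d, ℝ) | Typical (-f)} ∈ residual C(cube d, ℝ) :=
  tendsto_residual_of_isOpenMap (Homeomorph.neg C(cube d, ℝ)).continuous
    (Homeomorph.neg C(cube d, ℝ)).isOpenMap (typical_mem_residual hd)

theorem hausdorffDim_eq_natCast {d k : ℕ} {s : Set (Space d)} (hne : s.Nonempty)
    (h : dimH s = k) : hausdorffDim s = ((k : ℝ) : EReal) := by
  rw [hausdorffDim, if_neg hne.ne_empty, h]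
  rfl

/-! ### Hölder exponents and spectrum of the upper envelope -/

namespace Typical

section

variable {d : ℕ} {f : C(cube d, ℝ)}

theorem contDiffOn (H : Typical f) : ContDiffOn ℝ 1 (envelope 1 f) (openCube d) :=
  contDiffOn_envelope H.steep_zero H.steep_one H.wedgeFree

theorem holderExponent_of_notMem_openCube (H : Typical f) {x : Space d} (hx : x ∈ cube d) (hx' : x ∉ openCube d) :
    holderExponent (envelope 1 f) x = 0 := by
  obtain ⟨j, a, ha, hxa⟩ := exists_mem_face_of_notMem_openCube hx hx'
  rcases ha with rfl | rfl
  · exact holderExponent_eq_zero (Or.inl rfl) (H.steep_zero j) hxa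
  · exact holderExponent_eq_zero (Or.inr rfl) (H.steep_one j) hxa

theorem holderExponent_of_lowRep (H : Typical f) {x : Space d} (hx : x ∈ openCube d) (h : LowRep f x) :
    holderExponent (envelope 1 f) x = 1 :=
  le_antisymm (holderExponent_le_one hx h H.sharpRidges) (one_le_holderExponent
    ((H.contDiffOn.differentiableOn one_ne_zero).differentiableAt
      ((isOpen_openCube d).mem_nhds hx)))

theorem holderLevelSet_eq_empty (H : Typical f) {h : ℝ≥0∞} (h0 : 0 < h) (htop : h < ⊤) (h1 : h ≠ 1) :
    holderLevelSet (envelope 1 f) h = ∅ := by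
  refine eq_empty_of_forall_notMem ?_
  rintro x ⟨hx, rfl⟩
  by_cases hxo : x ∈ openCube d
  · rcases affine_or_lowRep (f := f) hxo with ⟨p, c, hpc⟩ | hlow
    · exact htop.ne (holderExponent_eq_top_of_affine hpc)
    · exact h1 (H.holderExponent_of_lowRep hxo hlow)
  · exact h0.ne' (H.holderExponent_of_notMem_openCube hx hxo)

theorem one_le_holderExponent_of_mem_openCube (H : Typical f) {x : Space d} (hx : x ∈ openCube d) :
    1 ≤ holderExponent (envelope 1 f) x := by
  rcases affine_or_lowRep (f := f) hx with ⟨p, c, hpc⟩ | hlow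
  · rw [holderExponent_eq_top_of_affine hpc]; exact le_top
  · exact (H.holderExponent_of_lowRep hx hlow).ge

theorem holderLevelSet_zero (H : Typical f) : holderLevelSet (envelope 1 f) 0 = cube d \ openCube d := by
  ext x
  constructor
  · rintro ⟨hx, h0⟩
    refine ⟨hx, fun hxo => ?_⟩
    have := H.one_le_holderExponent_of_mem_openCube hxo
    rw [h0] at this
    simp at this
  · rintro ⟨hx, hxo⟩
    exact ⟨hx, H.holderExponent_of_notMem_openCube hx hxo⟩

theorem holderLevelSet_one_subset (H : Typical f) : holderLevelSet (envelope 1 f) 1 ⊆ {x | LowRep f x} := by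
  rintro x ⟨hx, h1⟩
  by_cases hxo : x ∈ openCube d
  · rcases affine_or_lowRep (f := f) hxo with ⟨p, c, hpc⟩ | hlow
    · rw [holderExponent_eq_top_of_affine hpc] at h1
      simp at h1
    · exact hlow
  · rw [H.holderExponent_of_notMem_openCube hx hxo] at h1
    simp at h1

theorem hausdorffDim_contactSet (H : Typical f) : hausdorffDim (contactSet 1 f) = 0 := by
  obtain ⟨x, hx⟩ := (interior_openCube_nonempty d).mono interior_subset
  obtain ⟨p, c, hmaj, hval⟩ := exists_majorant f hx
  obtain ⟨ι, _, w, z, hw, h1, hsum, hv⟩ := exists_sum_eq_envelope f (openCube_subset_cube d hx)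
  have hι : Nonempty ι := by
    by_contra hι
    rw [not_nonempty_iff] at hι
    simp at h1
  obtain ⟨i⟩ := hι
  -- Nonemptiness matters: the empty set would have dimension `⊥`, not 0.
  have hne : (contactSet 1 f).Nonempty := ⟨z i, mem_contactSet_of_majorant hmaj
    (eq_of_majorant_of_sum_eq hmaj hw h1 (by rw [hv, hval, hsum]) i)⟩
  simpa using hausdorffDim_eq_natCast (k := 0) hne (by simpa using dimH_contactSet H.thinContact)

end

section

variable {m : ℕ} {f : C(cube (m + 1), ℝ)}

theorem spectrumHolder_zero (H : Typical f) : spectrumHolder (envelope 1 f) 0 = ((m : ℝ) : EReal) := by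
  have hface : ∀ v ∈ openCube m, ∃ x ∈ cube (m + 1) \ openCube (m + 1), dropFirst x = v :=
    fun v hv => by
      refine ⟨WithLp.toLp 2 (Fin.cons 0 fun k => v k), ⟨?_, fun h => ?_⟩, ?_⟩
      · refine Fin.cases ?_ fun k => ?_
        · simp
        · simpa using Ioo_subset_Icc_self (hv k)
      · simpa using h 0
      · ext k; simp [dropFirst]
  rw [spectrumHolder, H.holderLevelSet_zero]
  refine hausdorffDim_eq_natCast ?_ (le_antisymm ?_ (le_dimH_of_dropFirst fun v hv => hface v hv))
  · obtain ⟨v, hv⟩ := (interior_openCube_nonempty m).mono interior_subset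
    obtain ⟨x, hx, -⟩ := hface v hv
    exact ⟨x, hx⟩
  · have hsub : cube (m + 1) \ openCube (m + 1) ⊆ ⋃ j, (face 0 j ∪ face 1 j) := by
      rintro x ⟨hx, hxo⟩
      obtain ⟨j, a, ha, hxa⟩ := exists_mem_face_of_notMem_openCube hx hxo
      rcases ha with rfl | rfl
      · exact mem_iUnion.2 ⟨j, Or.inl hxa⟩
      · exact mem_iUnion.2 ⟨j, Or.inr hxa⟩
    refine (dimH_mono hsub).trans ?_
    rw [dimH_iUnion]
    refine iSup_le fun j => ?_
    rw [dimH_union]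
    exact max_le (dimH_face_le 0 j) (dimH_face_le 1 j)

theorem spectrumHolder_one (H : Typical f) : spectrumHolder (envelope 1 f) 1 = ((m : ℝ) : EReal) := by
  have hline : ∀ v ∈ openCube m, ∃ x ∈ holderLevelSet (envelope 1 f) 1, dropFirst x = v :=
    fun v hv => by
      set x₀ : Space (m + 1) := WithLp.toLp 2 (Fin.cons 0 fun k => v k)
      have hx₀ : x₀ ∈ face 0 (0 : Fin (m + 1)) := by
        refine ⟨Fin.cases ?_ fun k => ?_, by simp [x₀]⟩
        · simp [x₀]
        · simpa [x₀] using Ioo_subset_Icc_self (hv k)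
      obtain ⟨t, ht, hna⟩ := exists_not_affine_on_line (H.steep_zero 0) hx₀
      have hxo : inward 0 0 t x₀ ∈ openCube (m + 1) := by
        refine Fin.cases ?_ fun k => ?_
        · rw [inward_apply_self, hx₀.2]; simpa using ht
        · rw [inward_apply_of_ne 0 (Fin.succ_ne_zero k)]
          simpa [x₀] using hv k
      refine ⟨_, ⟨openCube_subset_cube _ hxo, H.holderExponent_of_lowRep hxo
        ((affine_or_lowRep hxo).resolve_left hna)⟩, ?_⟩
      ext k
      simp only [dropFirst]
      rw [inward_apply_of_ne 0 (Fin.succ_ne_zero k)]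
      simp [x₀]
  refine hausdorffDim_eq_natCast ?_ (le_antisymm ((dimH_mono H.holderLevelSet_one_subset).trans
    (dimH_lowRep_le H.thinContact)) (le_dimH_of_dropFirst fun v hv => hline v hv))
  obtain ⟨v, hv⟩ := (interior_openCube_nonempty m).mono interior_subset
  obtain ⟨x, hx, -⟩ := hline v hv
  exact ⟨x, hx⟩

/-- The open cube has dimension `m + 1` and the points with a low representation at most `m`, so the
rest must carry the full dimension. -/
theorem spectrumHolder_top (H : Typical f) : spectrumHolder (envelope 1 f) ⊤ = (((m + 1 : ℕ) : ℝ) : EReal) := by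
  have hsub : openCube (m + 1) ⊆ holderLevelSet (envelope 1 f) ⊤ ∪ {x | LowRep f x} := by
    intro x hx
    rcases affine_or_lowRep (f := f) hx with ⟨p, c, hpc⟩ | hlow
    · exact Or.inl ⟨openCube_subset_cube _ hx, holderExponent_eq_top_of_affine hpc⟩
    · exact Or.inr hlow
  have hle := dimH_mono hsub
  rw [dimH_openCube, dimH_union] at hle
  have hlt : (m : ℝ≥0∞) < (m + 1 : ℕ) := by exact_mod_cast Nat.lt_succ_self m
  have hge : ((m + 1 : ℕ) : ℝ≥0∞) ≤ dimH (holderLevelSet (envelope 1 f) ⊤) :=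
    (le_max_iff.1 hle).resolve_right fun h =>
      absurd (h.trans (dimH_lowRep_le H.thinContact)) (not_le.2 hlt)
  refine hausdorffDim_eq_natCast ?_ (le_antisymm ?_ hge)
  · rw [nonempty_iff_ne_empty]
    intro h
    rw [h, dimH_empty] at hge
    simp at hge
  · refine (dimH_mono (subset_univ _)).trans (le_of_eq ?_)
    rw [Real.dimH_univ_eq_finrank, finrank_euclideanSpace_fin]

end

end Typical

/-! ### The lower envelope -/

variable {d : ℕ}

theorem neg_mem_graphHull_neg {f : C(cube d, ℝ)} {x : Space d} {y : ℝ} (h : (x, y) ∈ graphHull f) :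
    (x, -y) ∈ graphHull (-f) := by
  let L : Space d × ℝ →ₗ[ℝ] Space d × ℝ := LinearMap.id.prodMap (-LinearMap.id)
  have := mem_image_of_mem L h
  rw [graphHull, L.image_convexHull, ← range_comp] at this
  simpa [graphHull, L, Function.comp_def] using this

theorem envelope_two (f : C(cube d, ℝ)) : envelope 2 f = fun x => -envelope 1 (-f) x := by
  funext x
  have : -{y | (x, y) ∈ graphHull f} = {y | (x, y) ∈ graphHull (-f)} := by
    ext y
    constructor
    · intro h
      simpa using neg_mem_graphHull_neg (f := f) h
    · intro h
      simpa using neg_mem_graphHull_neg (f := -f) h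
  rw [envelope_one, ← this, ← Real.sInf_def]
  simp [envelope]

theorem contactSet_two (f : C(cube d, ℝ)) : contactSet 2 f = contactSet 1 (-f) := by
  ext x
  simp only [contactSet, envelope_two, mem_ofPred_eq, ContinuousMap.neg_apply, neg_eq_iff_eq_neg]

theorem memHolderAt_neg {φ : Space d → ℝ} {h : ℝ≥0} {x : Space d} (H : MemHolderAt φ h x) :
    MemHolderAt (fun y => -φ y) h x := by
  obtain ⟨P, hP, C, hC⟩ := H
  refine ⟨-P, by rwa [MvPolynomial.totalDegree_neg], C, hC.mono fun y hy => ?_⟩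
  rw [map_neg, ← neg_sub', abs_neg]
  exact hy

theorem holderExponent_neg (φ : Space d → ℝ) :
    holderExponent (fun y => -φ y) = holderExponent φ := by
  have h : ∀ h x, MemHolderAt (fun y => -φ y) h x ↔ MemHolderAt φ h x := fun h x =>
    ⟨fun H => by simpa using memHolderAt_neg H, memHolderAt_neg⟩
  funext x
  simp only [holderExponent, h]

theorem holderLevelSet_neg (φ : Space d → ℝ) :
    holderLevelSet (fun y => -φ y) = holderLevelSet φ := by
  funext h
  simp only [holderLevelSet, holderExponent_neg]

theorem spectrumHolder_neg (φ : Space d → ℝ) :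
    spectrumHolder (fun y => -φ y) = spectrumHolder φ := by
  funext h
  simp only [spectrumHolder, holderLevelSet_neg]

theorem HasRightPartial.neg {φ : Space d → ℝ} {j : Fin d} {x : Space d} {L : EReal}
    (h : HasRightPartial φ j x L) : HasRightPartial (fun y => -φ y) j x (-L) := by
  refine ((continuous_neg.tendsto L).comp h).congr fun t => ?_
  rw [Function.comp_apply, ← EReal.coe_neg]
  congr 1
  ring

theorem HasLeftPartial.neg {φ : Space d → ℝ} {j : Fin d} {x : Space d} {L : EReal}
    (h : HasLeftPartial φ j x L) : HasLeftPartial (fun y => -φ y) j x (-L) := by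
  refine ((continuous_neg.tendsto L).comp h).congr fun t => ?_
  rw [Function.comp_apply, ← EReal.coe_neg]
  congr 1
  ring

end ConvexHullGraph

/-! ### The structure theorem for both envelopes -/

open ConvexHullGraph in
theorem theorem1 (d : ℕ) (hd : 1 ≤ d) :
    ∃ G : Set C(ConvexHullGraph.cube d, ℝ), Dense G ∧ IsGδ G ∧
      ∀ f ∈ G, ∀ i : ℕ, i = 1 ∨ i = 2 →
        ContDiffOn ℝ 1 (ConvexHullGraph.envelope i f) (ConvexHullGraph.openCube d) ∧
        (∀ x ∈ frontier (ConvexHullGraph.cube d),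
          ConvexHullGraph.holderExponent (ConvexHullGraph.envelope i f) x = 0) ∧
        ConvexHullGraph.spectrumHolder (ConvexHullGraph.envelope i f) 0
          = (((d : ℝ) - 1 : ℝ) : EReal) ∧
        ConvexHullGraph.holderLevelSet (ConvexHullGraph.envelope i f) 0
          ∩ ConvexHullGraph.openCube d = ∅ ∧
        ConvexHullGraph.spectrumHolder (ConvexHullGraph.envelope i f) 1
          = (((d : ℝ) - 1 : ℝ) : EReal) ∧
        ConvexHullGraph.spectrumHolder (ConvexHullGraph.envelope i f) ⊤
          = ((d : ℝ) : EReal) ∧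
        (∀ h : ℝ≥0∞, 0 < h → h < ⊤ → h ≠ 1 →
          ConvexHullGraph.spectrumHolder (ConvexHullGraph.envelope i f) h = ⊥ ∧
          ConvexHullGraph.holderLevelSet (ConvexHullGraph.envelope i f) h = ∅) ∧
        (∀ j : Fin d,
          (∀ x ∈ ConvexHullGraph.face 0 j,
            ConvexHullGraph.HasRightPartial (ConvexHullGraph.envelope i f) j x
              ((-1) ^ (i + 1) * ⊤)) ∧
          (∀ x ∈ ConvexHullGraph.face 1 j,
            ConvexHullGraph.HasLeftPartial (ConvexHullGraph.envelope i f) j x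
              ((-1) ^ i * ⊤))) ∧
        ConvexHullGraph.hausdorffDim (ConvexHullGraph.contactSet i f) = 0 := by
  obtain ⟨m, rfl⟩ : ∃ m, d = m + 1 := ⟨d - 1, by omega⟩
  -- A single dense Gδ set serves both envelopes: on it `f` and `-f` are both typical.
  obtain ⟨G, hGsub, hGδ, hGd⟩ := mem_residual.1
    (inter_mem (typical_mem_residual hd) (typical_neg_mem_residual hd))
  have hm : ((((m + 1 : ℕ) : ℝ) - 1 : ℝ) : EReal) = ((m : ℝ) : EReal) := by
    rw [Nat.cast_add_one, add_sub_cancel_right]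
  have key : ∀ g : C(cube (m + 1), ℝ), Typical g →
      (∀ x ∈ frontier (cube (m + 1)), holderExponent (envelope 1 g) x = 0) ∧
      holderLevelSet (envelope 1 g) 0 ∩ openCube (m + 1) = ∅ ∧
      (∀ h : ℝ≥0∞, 0 < h → h < ⊤ → h ≠ 1 → spectrumHolder (envelope 1 g) h = ⊥ ∧
        holderLevelSet (envelope 1 g) h = ∅) := fun g H => by
    refine ⟨fun x hx => ?_, ?_, fun h h0 htop h1 => ?_⟩
    · obtain ⟨hx, hxo⟩ := notMem_openCube_of_mem_frontier hx
      exact H.holderExponent_of_notMem_openCube hx hxo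
    · rw [H.holderLevelSet_zero, sdiff_inter_self]
    · have := H.holderLevelSet_eq_empty h0 htop h1
      exact ⟨by rw [spectrumHolder, this, hausdorffDim, if_pos rfl], this⟩
  refine ⟨G, hGd, hGδ, fun f hf i hi => ?_⟩
  obtain ⟨H₁, H₂⟩ := hGsub hf
  have H₁ : Typical f := H₁
  have H₂ : Typical (-f) := H₂
  rw [hm]
  rcases hi with rfl | rfl
  · obtain ⟨k1, k2, k3⟩ := key f H₁
    refine ⟨H₁.contDiffOn, k1, H₁.spectrumHolder_zero, k2, H₁.spectrumHolder_one,
      H₁.spectrumHolder_top, k3, fun j => ⟨fun x hx => ?_, fun x hx => ?_⟩,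
      H₁.hausdorffDim_contactSet⟩
    · simpa using hasRightPartial_envelope (H₁.steep_zero j) hx
    · simpa using hasLeftPartial_envelope (H₁.steep_one j) hx
  · obtain ⟨k1, k2, k3⟩ := key (-f) H₂
    rw [envelope_two, holderExponent_neg, spectrumHolder_neg, holderLevelSet_neg, contactSet_two]
    refine ⟨H₂.contDiffOn.neg, k1, H₂.spectrumHolder_zero, k2, H₂.spectrumHolder_one,
      H₂.spectrumHolder_top, k3, fun j => ⟨fun x hx => ?_, fun x hx => ?_⟩,
      H₂.hausdorffDim_contactSet⟩
    · simpa [pow_succ] using (hasRightPartial_envelope (H₂.steep_zero j) hx).neg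
    · simpa using (hasLeftPartial_envelope (H₂.steep_one j) hx).neg
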